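/- **Theorem 3.2.** Let $l,T>0$, $v\in\mathbb R$, $H=L^2(0,l)$, $U=\mathbb R^m$. Let $\phi_1,\dots,\phi_{\tilde\ell}\in C^1_{\mathrm{per}}([0,l])=\{\phi\in C^1([0,l]) : \phi(0)=\phi(l),\ \phi'(0)=\phi'(l)\}$ be orthonormal in $H$ and such that $\phi_1,\dots,\phi_{\tilde\ell},\phi_1',\dots,\phi_{\tilde\ell}'$ are linearly independent. Let $b_1,\dots,b_m\in H^1_{\mathrm{per}}(0,l)\setminus\{0\}$, where $H^1_{\mathrm{per}}(0,l)=\{f\in H^1(0,l): f(0)=f(l)\}$, let $\mathcal B u=\sum_{k=1}^m u_k b_k$ for $u\in U$, and let $\alpha_0\in\mathbb R^{\tilde\ell}\setminus\{0\}$, $z_0\in\mathbb R$ and $y_{\mathrm d}\in L^2(0,T;H)$. For $z\in\mathbb R$ let $\mathcal T(z)\in\mathcal L(H)$ be the periodic shift: with $\eta=z \bmod l\in[0,l)$, $(\mathcal T(z)\phi)(x)=\phi(x-\eta)$ if $\eta\le x$, and $(\mathcal T(z)\phi)(x)=\phi(x-\eta+l)$ if $x<\eta$; and let $\mathcal T'(z)\phi=\frac{\mathrm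 d}{\mathrm dz}(\mathcal T(z)\phi)$. Put $N=-[\langle\phi_i,\phi_j'\rangle_H]_{i,j}$, $M_2=[\langle\phi_i',\phi_j'\rangle_H]_{i,j}$, $B_1(z)=[\langle\mathcal T(z)\phi_i,\mathcal Be_j\rangle_H]_{i,j}$, $B_2(z)=[\langle\mathcal T'(z)\phi_i,\mathcal Be_j\rangle_H]_{i,j}$. For $u\in L^2(0,T;U)$ consider the sPOD-Galerkin reduced-order model $$\begin{bmatrix} I & N\alpha\\ \alpha^\top N^\top & \alpha^\top M_2\alpha\end{bmatrix}\begin{bmatrix}\dot\alpha\\ \dot z\end{bmatrix}=v\begin{bmatrix}N&0\\ \alpha^\top M_2&0\end{bmatrix}\begin{bmatrix}\alpha\\ z\end{bmatrix}+\begin{bmatrix}B_1(z)\\ \alpha^\top B_2(z)\end{bmatrix}u\quad\text{on }(0,T),\qquad \alpha(0)=\alpha_0,\ z(0)=z_0, \tag{1}$$ whose solutions $(\alpha,z):[0,T]\to\mathbb R^{\tilde\ell}\times\mathbb R$ are understood in the sense of Carathéodory (absolutely continuous, the equation holding for almost every $t$), and for $\mu>0$ the cost $$\mathcal J_\mu(\alpha,z,u)=\frac12\int_0^T\Big\|\sum_{i=1}^{\tilde\ell}\alpha_i(t)\,\mathcal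 T(z(t))\phi_i-y_{\mathrm d}(t)\Big\|_H^2\,\mathrm dt+\frac\mu2\int_0^T\|u(t)\|_U^2\,\mathrm dt .$$ Then there is $\mu_0>0$ such that for every $\mu\ge\mu_0$ the optimal control problem of minimizing $\mathcal J_\mu(\alpha,z,u)$ over all $u\in L^2(0,T;U)$ and all solutions $(\alpha,z)$ of (1) has an optimal control: there exist $\bar u\in L^2(0,T;U)$ and a solution $(\bar\alpha,\bar z)\in H^1(0,T;\mathbb R^{\tilde\ell})\times H^1(0,T)$ of (1) for $u=\bar u$ with $\mathcal J_\mu(\bar\alpha,\bar z,\bar u)\le\mathcal J_\mu(\alpha,z,u)$ for every $u\in L^2(0,T;U)$ and every solution $(\alpha,z)$ of (1). -/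

import Mathlib

open MeasureTheory Set
open scoped ContDiff Matrix

namespace SPOD

noncomputable section

/-- The Hilbert space `L²(a, b; E)`. -/
abbrev L2 (a b : ℝ) (E : Type) [NormedAddCommGroup E] : Type :=
  Lp E 2 (volume.restrict (Ioo a b))

/-- The state space `H = L²(0, l)`. -/
abbrev H (l : ℝ) : Type := L2 0 l ℝ

/-- `g` is a weak derivative of `f` on `(a, b)`, tested against `C_c^∞(a, b)`. -/
def IsWeakDeriv {E : Type} [NormedAddCommGroup E] [NormedSpace ℝ E]
    (a b : ℝ) (f g : ℝ → E) : Prop :=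
  ∀ ψ : ℝ → ℝ, ContDiff ℝ ∞ ψ → HasCompactSupport ψ → tsupport ψ ⊆ Ioo a b →
    ∫ x in Ioo a b, deriv ψ x • f x = -∫ x in Ioo a b, ψ x • g x

/-- `f ∈ H¹(a, b; E)`. -/
def IsH1 {E : Type} [NormedAddCommGroup E] [NormedSpace ℝ E]
    (a b : ℝ) (f : ℝ → E) : Prop :=
  MemLp f 2 (volume.restrict (Ioo a b)) ∧
    ∃ g : ℝ → E, MemLp g 2 (volume.restrict (Ioo a b)) ∧ IsWeakDeriv a b f g

/-- `H¹_per(0, l)`: the classes in `L²(0, l)` of the functions in `H¹(0, l)` whose continuous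
representative `F` satisfies `F 0 = F l`. -/
def H1Per (l : ℝ) : Set (H l) :=
  {f | ∃ F : ℝ → ℝ, f =ᵐ[volume.restrict (Ioo 0 l)] F ∧ ContinuousOn F (Icc 0 l) ∧
    F 0 = F l ∧ IsH1 0 l F}

/-- `C¹_per([0, l])`: functions that are `C¹` on `[0, l]` (one-sidedly at the end points), with
`φ 0 = φ l` and `φ' 0 = φ' l`. The values outside `[0, l]` play no role. -/
structure C1Per (l : ℝ) where
  toFun : ℝ → ℝ
  contDiffOn : ContDiffOn ℝ 1 toFun (Icc 0 l)
  map_eq : toFun 0 = toFun l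
  deriv_eq : derivWithin toFun (Icc 0 l) 0 = derivWithin toFun (Icc 0 l) l

theorem memLp_of_continuousOn {l : ℝ} {f : ℝ → ℝ} (hf : ContinuousOn f (Icc 0 l)) :
    MemLp f 2 (volume.restrict (Ioo 0 l)) := by
  obtain ⟨C, hC⟩ := isCompact_Icc.exists_bound_of_continuousOn hf
  refine MemLp.of_bound
    ((hf.mono Ioo_subset_Icc_self).aestronglyMeasurable measurableSet_Ioo) C ?_
  filter_upwards [ae_restrict_mem measurableSet_Ioo] with x hx
  exact hC x (Ioo_subset_Icc_self hx)

theorem C1Per.continuousOn_deriv {l : ℝ} (φ : C1Per l) :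
    ContinuousOn (derivWithin φ.toFun (Icc 0 l)) (Icc 0 l) := by
  rcases lt_or_ge 0 l with h | h
  · exact φ.contDiffOn.continuousOn_derivWithin (uniqueDiffOn_Icc h) le_rfl
  · exact (subsingleton_Icc_of_ge h).continuousOn _

/-- `φ` as an element of `H`. -/
def C1Per.toL2 {l : ℝ} (φ : C1Per l) : H l :=
  (memLp_of_continuousOn φ.contDiffOn.continuousOn).toLp φ.toFun

/-- The derivative `φ'` as an element of `H`. -/
def C1Per.derivL2 {l : ℝ} (φ : C1Per l) : H l :=
  (memLp_of_continuousOn φ.continuousOn_deriv).toLp (derivWithin φ.toFun (Icc 0 l))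

/-- `z mod l`. -/
def shiftMod (l z : ℝ) : ℝ := Int.fract (z / l) * l

/-- The change of variables of the periodic shift. -/
def shiftPoint (l z x : ℝ) : ℝ :=
  if shiftMod l z ≤ x then x - shiftMod l z else x - shiftMod l z + l

theorem measurable_shiftPoint (l z : ℝ) : Measurable (shiftPoint l z) :=
  Measurable.ite measurableSet_Ici (measurable_id.sub_const _)
    ((measurable_id.sub_const _).add_const _)

theorem measurePreserving_shiftPoint (l z : ℝ) :
    MeasurePreserving (shiftPoint l z) (volume.restrict (Ioo 0 l))
      (volume.restrict (Ioo 0 l)) := by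
  refine ⟨measurable_shiftPoint l z, ?_⟩
  rcases le_or_gt l 0 with hl | hl
  · simp [Ioo_eq_empty (not_lt.mpr hl)]
  have h0 : 0 ≤ shiftMod l z := mul_nonneg (Int.fract_nonneg _) hl.le
  have h1 : shiftMod l z < l := by
    have := Int.fract_lt_one (z / l)
    unfold shiftMod
    nlinarith
  rw [Measure.restrict_congr_set (Ioo_ae_eq_Ico (μ := volume) (a := (0 : ℝ)) (b := l))]
  ext s hs
  rw [Measure.map_apply (measurable_shiftPoint l z) hs,
    Measure.restrict_apply (measurable_shiftPoint l z hs), Measure.restrict_apply hs]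
  set η := shiftMod l z with hη
  have e1 : shiftPoint l z ⁻¹' s ∩ Ico 0 l =
      ((fun x => x + (-η)) ⁻¹' (s ∩ Ico 0 (l - η))) ∪
        ((fun x => x + (l - η)) ⁻¹' (s ∩ Ico (l - η) l)) := by
    ext x
    simp only [shiftPoint, ← hη, mem_inter_iff, mem_preimage, mem_Ico, mem_union]
    by_cases hx : η ≤ x
    · rw [if_pos hx, sub_eq_add_neg]
      constructor
      · rintro ⟨a, b, c⟩
        exact Or.inl ⟨a, by linarith, by linarith⟩
      · rintro (⟨a, b, c⟩ | ⟨a, b, c⟩)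
        · exact ⟨a, by linarith, by linarith⟩
        · linarith
    · rw [if_neg hx, show x - η + l = x + (l - η) by ring]
      push Not at hx
      constructor
      · rintro ⟨a, b, c⟩
        exact Or.inr ⟨a, by linarith, by linarith⟩
      · rintro (⟨a, b, c⟩ | ⟨a, b, c⟩)
        · linarith
        · exact ⟨a, by linarith, by linarith⟩
  have e2 : s ∩ Ico 0 l = (s ∩ Ico 0 (l - η)) ∪ (s ∩ Ico (l - η) l) := by
    rw [← inter_union_distrib_left, Ico_union_Ico_eq_Ico (by linarith) (by linarith)]
  have m2 : MeasurableSet (s ∩ Ico (l - η) l) := hs.inter measurableSet_Ico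
  have m3 : MeasurableSet ((fun x => x + (l - η)) ⁻¹' (s ∩ Ico (l - η) l)) :=
    (measurable_add_const (l - η)) m2
  rw [e1, e2, measure_union _ m3, measure_union _ m2,
    measure_preimage_add_right, measure_preimage_add_right]
  · refine Set.disjoint_left.mpr ?_
    rintro x ⟨-, hx⟩ ⟨-, hx'⟩
    exact absurd hx.2 (not_lt.mpr hx'.1)
  · refine Set.disjoint_left.mpr ?_
    rintro x ⟨-, hx⟩ ⟨-, hx'⟩
    simp only [mem_Ico] at hx hx'
    linarith

/-- The periodic shift operator `𝒯 : ℝ → 𝓛(L²(0, l))`. -/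
def shift (l z : ℝ) : H l →L[ℝ] H l :=
  (Lp.compMeasurePreservingₗᵢ ℝ (shiftPoint l z)
    (measurePreserving_shiftPoint l z)).toContinuousLinearMap

/-- The pointwise formula that characterizes `𝒯(z)`. -/
theorem shift_ae_eq (l z : ℝ) (f : H l) :
    shift l z f =ᵐ[volume.restrict (Ioo 0 l)] fun x =>
      if shiftMod l z ≤ x then f (x - shiftMod l z) else f (x - shiftMod l z + l) := by
  refine (Lp.coeFn_compMeasurePreserving f (measurePreserving_shiftPoint l z)).trans
    (Filter.Eventually.of_forall fun x => ?_)
  simp only [Function.comp, shiftPoint]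
  split_ifs <;> rfl

/-- `𝒯'(z) f = d/dz (𝒯(z) f)`, the derivative being taken in the norm of `H`. -/
def shiftDeriv (l z : ℝ) (f : H l) : H l := deriv (fun ζ => shift l ζ f) z

/-- The control operator `ℬ u = ∑ₖ uₖ bₖ` from `U = ℝᵐ` to `H`. -/
def controlOp {l : ℝ} {m : ℕ} (b : Fin m → H l) : EuclideanSpace ℝ (Fin m) →L[ℝ] H l :=
  ∑ k, (EuclideanSpace.proj k : EuclideanSpace ℝ (Fin m) →L[ℝ] ℝ).smulRight (b k)

/-- `N = -[⟨φᵢ, φⱼ'⟩]`. -/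
def matN {l : ℝ} {n : ℕ} (φ : Fin n → C1Per l) : Matrix (Fin n) (Fin n) ℝ :=
  Matrix.of fun i j => -inner ℝ (φ i).toL2 (φ j).derivL2

/-- `M₂ = [⟨φᵢ', φⱼ'⟩]`. -/
def matM2 {l : ℝ} {n : ℕ} (φ : Fin n → C1Per l) : Matrix (Fin n) (Fin n) ℝ :=
  Matrix.of fun i j => inner ℝ (φ i).derivL2 (φ j).derivL2

/-- `B₁(z) = [⟨𝒯(z) φᵢ, ℬ eⱼ⟩]`. -/
def matB1 {l : ℝ} {n m : ℕ} (φ : Fin n → C1Per l) (b : Fin m → H l) (z : ℝ) :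
    Matrix (Fin n) (Fin m) ℝ :=
  Matrix.of fun i j =>
    inner ℝ (shift l z (φ i).toL2) (controlOp b (EuclideanSpace.single j 1))

/-- `B₂(z) = [⟨𝒯'(z) φᵢ, ℬ eⱼ⟩]`. -/
def matB2 {l : ℝ} {n m : ℕ} (φ : Fin n → C1Per l) (b : Fin m → H l) (z : ℝ) :
    Matrix (Fin n) (Fin m) ℝ :=
  Matrix.of fun i j =>
    inner ℝ (shiftDeriv l z (φ i).toL2) (controlOp b (EuclideanSpace.single j 1))

/-- `(α, z)` is a Carathéodory solution on `[0, T]` of the sPOD-G reduced-order model with control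
`u` and initial values `(α₀, z₀)`: it is absolutely continuous (hence differentiable almost
everywhere), attains the initial values, and satisfies for almost every `t ∈ (0, T)` the two block
rows of
`[I, Nα; αᵀNᵀ, αᵀM₂α] [α'; z'] = v [N, 0; αᵀM₂, 0] [α; z] + [B₁(z); αᵀB₂(z)] u`. -/
structure IsState {l : ℝ} {n m : ℕ} (T v : ℝ) (φ : Fin n → C1Per l) (b : Fin m → H l)
    (α₀ : EuclideanSpace ℝ (Fin n)) (z₀ : ℝ) (u : L2 0 T (EuclideanSpace ℝ (Fin m)))
    (α : ℝ → EuclideanSpace ℝ (Fin n)) (z : ℝ → ℝ) : Prop where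
  ac_alpha : AbsolutelyContinuousOnInterval α 0 T
  ac_z : AbsolutelyContinuousOnInterval z 0 T
  init_alpha : α 0 = α₀
  init_z : z 0 = z₀
  row_one : ∀ᵐ t ∂volume.restrict (Ioo 0 T),
    (deriv α t).ofLp + deriv z t • (matN φ *ᵥ (α t).ofLp) =
      v • (matN φ *ᵥ (α t).ofLp) + matB1 φ b (z t) *ᵥ (u t).ofLp
  row_two : ∀ᵐ t ∂volume.restrict (Ioo 0 T),
    (α t).ofLp ⬝ᵥ ((matN φ)ᵀ *ᵥ (deriv α t).ofLp) +
        ((α t).ofLp ⬝ᵥ (matM2 φ *ᵥ (α t).ofLp)) * deriv z t =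
      v * ((α t).ofLp ⬝ᵥ (matM2 φ *ᵥ (α t).ofLp)) +
        (α t).ofLp ⬝ᵥ (matB2 φ b (z t) *ᵥ (u t).ofLp)

/-- The cost functional
`½ ∫₀ᵀ ‖∑ᵢ αᵢ(t) 𝒯(z(t)) φᵢ - y_d(t)‖² dt + μ/2 ∫₀ᵀ ‖u(t)‖² dt`. -/
def cost {l : ℝ} {n m : ℕ} (T μ : ℝ) (φ : Fin n → C1Per l) (yd : L2 0 T (H l))
    (α : ℝ → EuclideanSpace ℝ (Fin n)) (z : ℝ → ℝ)
    (u : L2 0 T (EuclideanSpace ℝ (Fin m))) : ℝ :=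
  1 / 2 * (∫ t in Ioo 0 T, ‖(∑ i, α t i • shift l (z t) (φ i).toL2) - yd t‖ ^ 2) +
    μ / 2 * (∫ t in Ioo 0 T, ‖u t‖ ^ 2)

/-- `u` is an optimal control with corresponding optimal state `(α, z)`: the triple satisfies the
reduced-order initial value problem and has least cost among all triples that do, the control
ranging over all of `L²(0, T; ℝᵐ)`. -/
def IsOptimalControl {l : ℝ} {n m : ℕ} (T v μ : ℝ) (φ : Fin n → C1Per l) (b : Fin m → H l)
    (α₀ : EuclideanSpace ℝ (Fin n)) (z₀ : ℝ) (yd : L2 0 T (H l))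
    (u : L2 0 T (EuclideanSpace ℝ (Fin m)))
    (α : ℝ → EuclideanSpace ℝ (Fin n)) (z : ℝ → ℝ) : Prop :=
  IsState T v φ b α₀ z₀ u α z ∧
    ∀ (u' : L2 0 T (EuclideanSpace ℝ (Fin m))) (α' : ℝ → EuclideanSpace ℝ (Fin n))
      (z' : ℝ → ℝ), IsState T v φ b α₀ z₀ u' α' z' →
        cost T μ φ yd α z u ≤ cost T μ φ yd α' z' u'

end

end SPOD

/-! The proof is the direct method; the size of `μ` supplies the missing compactness. The
uncontrolled trajectory `α = α₀`, `z = z₀ + v t` is feasible and its cost does not depend on `μ`, so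
for large `μ` nearly optimal controls have norm at most a prescribed `δ`.

Small controls keep the model nondegenerate. By periodicity `N` is antisymmetric, so testing the
first row with `α` removes both `N` terms and bounds the change of `‖α‖²` by the control; hence
`‖α‖` stays between `‖α₀‖ / 2` and `2 ‖α₀‖` (`IsState.norm_alpha_mem_Icc`). The mass matrix is the
Gram matrix of the `φᵢ` and `-∑ αⱼ φⱼ'`, so linear independence and the lower bound on `‖α‖` yield
velocities at most `K (1 + ‖u‖)` (`exists_velocity_bound`). Controls and velocities are then bounded
in `L²`, uniformly along a minimizing sequence (`exists_uniform_bounds`).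

Weak limits of velocities give pointwise limits of states. The rows are linear in `(α', z', u)`,
with coefficients continuous in `(α, z)` because the shift group is strongly continuous, so each
product pairs a strongly with a weakly convergent factor and the limit is again a state
(`ae_eq_of_weak_limit`, `exists_subseq_tendsto_state`). The tracking term converges and the norm is
weakly lower semicontinuous. Uniqueness of states is never needed, since the minimum runs over
control-state triples. -/

namespace SPOD

open Filter Topology

/-! ### Absolutely continuous functions with values in a normed space -/

section AbsoluteContinuity

theorem absolutelyContinuousOnInterval_of_dist_le {X Y : Type*} [PseudoMetricSpace X]
    [PseudoMetricSpace Y] {f : ℝ → X} {g : ℝ → Y} {a b C : ℝ}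
    (hg : AbsolutelyContinuousOnInterval g a b)
    (h : ∀ s ∈ uIcc a b, ∀ t ∈ uIcc a b, dist (f s) (f t) ≤ C * dist (g s) (g t)) :
    AbsolutelyContinuousOnInterval f a b := by
  unfold AbsolutelyContinuousOnInterval at hg ⊢
  refine squeeze_zero' (Eventually.of_forall fun E => Finset.sum_nonneg fun _ _ => dist_nonneg) ?_
    (by simpa using hg.const_mul C)
  filter_upwards [mem_inf_of_right (mem_principal_self _)] with E hE
  rw [Finset.mul_sum]
  exact Finset.sum_le_sum fun i hi => h _ (hE.1 i hi).1 _ (hE.1 i hi).2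

variable {E : Type*} [NormedAddCommGroup E] [NormedSpace ℝ E]

theorem absolutelyContinuousOnInterval_integral {f : ℝ → E} {a b : ℝ}
    (hf : IntervalIntegrable f volume a b) (c : E) :
    AbsolutelyContinuousOnInterval (fun x => c + ∫ t in a..x, f t) a b := by
  refine absolutelyContinuousOnInterval_of_dist_le (C := 1)
    (hf.norm.absolutelyContinuousOnInterval_intervalIntegral (c := a) left_mem_uIcc) ?_
  intro s hs t ht
  have i1 : ∀ s ∈ uIcc a b, IntervalIntegrable f volume a s := fun s hs =>
    hf.mono_set (uIcc_subset_uIcc_left hs)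
  rw [dist_comm, dist_comm (∫ v in a..s, _), one_mul, dist_add_left, dist_eq_norm, dist_eq_norm,
    intervalIntegral.integral_interval_sub_left (i1 t ht) (i1 s hs),
    intervalIntegral.integral_interval_sub_left (i1 t ht).norm (i1 s hs).norm,
    Real.norm_eq_abs]
  exact intervalIntegral.norm_integral_le_abs_integral_norm

variable [FiniteDimensional ℝ E]

theorem hasDerivAt_integral_ae {f : ℝ → E} {a b : ℝ}
    (hf : IntervalIntegrable f volume a b) (c : E) :
    ∀ᵐ x, x ∈ uIcc a b → HasDerivAt (fun x => c + ∫ t in a..x, f t) (f x) x := by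
  have := FiniteDimensional.complete ℝ E
  filter_upwards [hf.ae_hasDerivAt_integral] with x hx hx'
  exact (hx hx' a left_mem_uIcc).const_add c

/-- The difference of `f` and the primitive of `deriv f` is absolutely continuous with zero
derivative almost everywhere, hence constant. -/
theorem eq_add_integral_deriv {f : ℝ → E} {a b : ℝ} (hab : a ≤ b)
    (hf : AbsolutelyContinuousOnInterval f a b) (hi : IntervalIntegrable (deriv f) volume a b) :
    ∀ x ∈ Icc a b, f x = f a + ∫ t in a..x, deriv f t := by
  have hg := hf.sub (absolutelyContinuousOnInterval_integral hi (f a))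
  obtain ⟨C, hC⟩ := hg.const_of_ae_hasDerivAt_zero (by
    filter_upwards [hf.boundedVariationOn.ae_differentiableAt_of_mem_uIcc,
      hasDerivAt_integral_ae hi (f a)] with x h1 h2 hx
    simpa using (h1 hx).hasDerivAt.sub (h2 hx))
  rw [uIcc_of_le hab] at hC
  intro x hx
  have h1 := hC x hx
  have h2 := hC a (left_mem_Icc.2 hab)
  simp only [Pi.sub_apply, intervalIntegral.integral_same, add_zero, sub_self] at h1 h2
  rw [← h2] at h1
  exact sub_eq_zero.1 h1

end AbsoluteContinuity

theorem intervalIntegrable_of_memLp {E : Type*} [NormedAddCommGroup E] {T : ℝ} (hT : 0 ≤ T)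
    {f : ℝ → E} (hf : MemLp f 2 (volume.restrict (Ioo 0 T))) :
    IntervalIntegrable f volume 0 T := by
  rw [intervalIntegrable_iff_integrableOn_Ioo_of_le hT]
  exact hf.integrable one_le_two

/-- The fundamental theorem applied to `ψ • f` is integration by parts; the boundary terms vanish
because `ψ` is supported inside `(0, T)`. -/
theorem isH1_of_absolutelyContinuous {E : Type} [NormedAddCommGroup E] [NormedSpace ℝ E]
    [FiniteDimensional ℝ E] {T : ℝ} (hT : 0 ≤ T) {f : ℝ → E}
    (hf : AbsolutelyContinuousOnInterval f 0 T)
    (hd : MemLp (deriv f) 2 (volume.restrict (Ioo 0 T))) : IsH1 0 T f := by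
  have := FiniteDimensional.complete ℝ E
  have hc : ContinuousOn f (Icc 0 T) := by simpa [uIcc_of_le hT] using hf.continuousOn
  refine ⟨?_, deriv f, hd, ?_⟩
  · obtain ⟨C, hC⟩ := isCompact_Icc.exists_bound_of_continuousOn hc
    refine MemLp.of_bound
      ((hc.mono Ioo_subset_Icc_self).aestronglyMeasurable measurableSet_Ioo) C ?_
    filter_upwards [ae_restrict_mem measurableSet_Ioo] with x hx
    exact hC x (Ioo_subset_Icc_self hx)
  · intro ψ hψ hψc hψs
    have hi := intervalIntegrable_of_memLp hT hd
    have hψ1 : ContDiff ℝ 1 ψ := hψ.of_le (by norm_cast)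
    have hac : AbsolutelyContinuousOnInterval (fun x => ψ x • f x) 0 T :=
      hψ1.contDiffOn.absolutelyContinuousOnInterval.fun_smul hf
    have i1 : IntervalIntegrable (fun x => ψ x • deriv f x) volume 0 T :=
      hi.continuousOn_smul hψ.continuous.continuousOn
    have i2 : IntervalIntegrable (fun x => deriv ψ x • f x) volume 0 T :=
      ((hψ1.continuous_deriv le_rfl).continuousOn.smul hf.continuousOn).intervalIntegrable
    have hae : ∀ᵐ x, x ∈ uIcc 0 T →
        deriv (fun x => ψ x • f x) x = ψ x • deriv f x + deriv ψ x • f x := by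
      filter_upwards [hf.boundedVariationOn.ae_differentiableAt_of_mem_uIcc] with x hx hx'
      exact ((hψ1.differentiable one_ne_zero x).hasDerivAt.smul (hx hx').hasDerivAt).deriv
    have hae' : ∀ᵐ x, x ∈ uIoc 0 T →
        ψ x • deriv f x + deriv ψ x • f x = deriv (fun x => ψ x • f x) x := by
      filter_upwards [hae] with x hx hx'
      exact (hx (uIoc_subset_uIcc hx')).symm
    have i3 : IntervalIntegrable (deriv fun x => ψ x • f x) volume 0 T :=
      (i1.add i2).congr_ae ((ae_restrict_iff' measurableSet_uIoc).2 hae')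
    have hz : ∀ x, x ∉ Ioo 0 T → ψ x = 0 := fun x hx =>
      image_eq_zero_of_notMem_tsupport fun h => hx (hψs h)
    have key := eq_add_integral_deriv hT hac i3 T (right_mem_Icc.2 hT)
    rw [hz 0 (by simp), hz T (by simp), ← intervalIntegral.integral_congr_ae hae',
      intervalIntegral.integral_add i1 i2] at key
    simp only [zero_smul, zero_add] at key
    rw [intervalIntegral.integral_of_le hT, intervalIntegral.integral_of_le hT,
      integral_Ioc_eq_integral_Ioo, integral_Ioc_eq_integral_Ioo] at key
    exact eq_neg_of_add_eq_zero_right key.symm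

/-! ### Weak convergence in Hilbert spaces -/

section WeakConvergence

variable {V : Type*} [NormedAddCommGroup V] [InnerProductSpace ℝ V]

/-- Sequential Banach–Alaoglu, carried over from the dual by the Riesz isomorphism. -/
theorem exists_subseq_weakly_convergent [CompleteSpace V] [TopologicalSpace.SeparableSpace V]
    {u : ℕ → V} {C : ℝ} (hu : ∀ k, ‖u k‖ ≤ C) :
    ∃ (w : V) (σ : ℕ → ℕ), StrictMono σ ∧
      ∀ y, Tendsto (fun k => inner ℝ (u (σ k)) y) atTop (𝓝 (inner ℝ w y)) := by
  obtain ⟨a, -, σ, hσ, ha⟩ := WeakDual.isSeqCompact_closedBall (𝕜 := ℝ) (E := V) 0 C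
    (x := fun k => StrongDual.toWeakDual (InnerProductSpace.toDual ℝ V (u k)))
    (fun k => by simpa using hu k)
  refine ⟨(InnerProductSpace.toDual ℝ V).symm (WeakDual.toStrongDual a), σ, hσ, fun y => ?_⟩
  rw [tendsto_iff_forall_eval_tendsto_topDualPairing] at ha
  rw [InnerProductSpace.toDual_symm_apply]
  exact ha y

theorem tendsto_inner_of_weak_of_strong {u y : ℕ → V} {u₀ y₀ : V} {C : ℝ}
    (hC : ∀ k, ‖u k‖ ≤ C)
    (hu : ∀ y, Tendsto (fun k => inner ℝ (u k) y) atTop (𝓝 (inner ℝ u₀ y)))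
    (hy : Tendsto y atTop (𝓝 y₀)) :
    Tendsto (fun k => inner ℝ (u k) (y k)) atTop (𝓝 (inner ℝ u₀ y₀)) := by
  have h1 : Tendsto (fun k => inner ℝ (u k) (y k - y₀)) atTop (𝓝 0) := by
    refine squeeze_zero_norm (fun k => (norm_inner_le_norm _ _).trans
      (mul_le_mul_of_nonneg_right (hC k) (norm_nonneg _))) ?_
    simpa using (tendsto_iff_norm_sub_tendsto_zero.1 hy).const_mul C
  simpa [inner_sub_right] using h1.add (hu y₀)

/-- Expand `0 ≤ ‖u k - u₀‖²` and pass to the limit: the right side tends to `L - ‖u₀‖²`. -/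
theorem sq_norm_le_of_weak {u : ℕ → V} {u₀ : V} {L : ℝ}
    (hu : ∀ y, Tendsto (fun k => inner ℝ (u k) y) atTop (𝓝 (inner ℝ u₀ y)))
    (hL : Tendsto (fun k => ‖u k‖ ^ 2) atTop (𝓝 L)) : ‖u₀‖ ^ 2 ≤ L := by
  have h1 := (hL.sub ((hu u₀).const_mul 2)).add_const (‖u₀‖ ^ 2)
  have h2 : 0 ≤ L - 2 * inner ℝ u₀ u₀ + ‖u₀‖ ^ 2 :=
    ge_of_tendsto' h1 fun k => by rw [← norm_sub_sq_real]; positivity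
  rw [real_inner_self_eq_norm_sq] at h2
  linarith

end WeakConvergence

/-! ### Strong and weak convergence in `L²` -/

section L2

variable {Ω : Type*} [MeasurableSpace Ω] {μ : Measure Ω}
  {W : Type*} [NormedAddCommGroup W] [InnerProductSpace ℝ W]

theorem norm_sq_eq_integral (f : Lp W 2 μ) : ‖f‖ ^ 2 = ∫ t, ‖f t‖ ^ 2 ∂μ := by
  rw [← real_inner_self_eq_norm_sq, L2.inner_def]
  simp only [real_inner_self_eq_norm_sq]

theorem tendsto_toLp_of_dominated [IsFiniteMeasure μ] {G : ℕ → Ω → W} {G₀ : Ω → W} {C : ℝ}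
    (hG : ∀ k, MemLp (G k) 2 μ) (hG₀ : MemLp G₀ 2 μ)
    (hC : ∀ k, ∀ᵐ t ∂μ, ‖G k t‖ ≤ C)
    (hlim : ∀ᵐ t ∂μ, Tendsto (fun k => G k t) atTop (𝓝 (G₀ t))) :
    Tendsto (fun k => (hG k).toLp) atTop (𝓝 hG₀.toLp) := by
  rw [tendsto_iff_norm_sub_tendsto_zero]
  have e : ∀ k, ‖(hG k).toLp - hG₀.toLp‖ ^ 2 = ∫ t, ‖G k t - G₀ t‖ ^ 2 ∂μ := fun k => by
    rw [← MemLp.toLp_sub, norm_sq_eq_integral]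
    refine integral_congr_ae ?_
    filter_upwards [((hG k).sub hG₀).coeFn_toLp] with t ht
    rw [ht, Pi.sub_apply]
  have h0 : ∀ᵐ t ∂μ, ‖G₀ t‖ ≤ C := by
    filter_upwards [hlim, ae_all_iff.2 hC] with t h1 h2
    exact le_of_tendsto' h1.norm h2
  have h : Tendsto (fun k => ‖(hG k).toLp - hG₀.toLp‖ ^ 2) atTop (𝓝 0) := by
    simp only [e]
    have := tendsto_integral_of_dominated_convergence (μ := μ)
      (F := fun k t => ‖G k t - G₀ t‖ ^ 2) (f := fun _ => (0 : ℝ)) (fun _ => (C + C) ^ 2)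
      (fun k => ((hG k).aestronglyMeasurable.sub hG₀.aestronglyMeasurable).norm.pow 2)
      (integrable_const _) (fun k => by
        filter_upwards [hC k, h0] with t h1 h2
        rw [Real.norm_of_nonneg (by positivity)]
        have := norm_sub_le (G k t) (G₀ t)
        gcongr
        linarith) (by
        filter_upwards [hlim] with t ht
        simpa using (tendsto_iff_norm_sub_tendsto_zero.1 ht).pow 2)
    simpa using this
  have h2 := (Real.continuous_sqrt.tendsto 0).comp h
  simpa [Function.comp_def, Real.sqrt_sq] using h2

/-- A bounded, pointwise convergent sequence paired with a weakly convergent one. -/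
theorem tendsto_setIntegral_inner [IsFiniteMeasure μ] {G : ℕ → Ω → W} {G₀ : Ω → W} {C D : ℝ}
    {w : ℕ → Lp W 2 μ} {w₀ : Lp W 2 μ}
    (hG : ∀ k, AEStronglyMeasurable (G k) μ) (hC : ∀ k, ∀ᵐ t ∂μ, ‖G k t‖ ≤ C)
    (hlim : ∀ᵐ t ∂μ, Tendsto (fun k => G k t) atTop (𝓝 (G₀ t)))
    (hD : ∀ k, ‖w k‖ ≤ D)
    (hw : ∀ y, Tendsto (fun k => inner ℝ (w k) y) atTop (𝓝 (inner ℝ w₀ y)))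
    {s : Set Ω} (hs : MeasurableSet s) :
    Tendsto (fun k => ∫ t in s, inner ℝ (G k t) (w k t) ∂μ) atTop
      (𝓝 (∫ t in s, inner ℝ (G₀ t) (w₀ t) ∂μ)) := by
  have hm : ∀ k, MemLp (s.indicator (G k)) 2 μ := fun k =>
    (MemLp.of_bound (hG k) C (hC k)).indicator hs
  have h0 : MemLp (s.indicator G₀) 2 μ := by
    refine (MemLp.of_bound (aestronglyMeasurable_of_tendsto_ae atTop hG hlim) C ?_).indicator hs
    filter_upwards [hlim, ae_all_iff.2 hC] with t h1 h2
    exact le_of_tendsto' h1.norm h2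
  -- The indicator of `s` is absorbed into the strongly convergent factor, so the set integral
  -- becomes an inner product on the whole space.
  have hstr : Tendsto (fun k => (hm k).toLp) atTop (𝓝 h0.toLp) := by
    refine tendsto_toLp_of_dominated (C := C) hm h0 (fun k => ?_) ?_
    · filter_upwards [hC k] with t ht
      exact (norm_indicator_le_norm_self _ _).trans ht
    · filter_upwards [hlim] with t ht
      by_cases h : t ∈ s <;> simp [h, ht]
  have e : ∀ (F : Ω → W) (hF : MemLp (s.indicator F) 2 μ) (x : Lp W 2 μ),
      ∫ t in s, inner ℝ (F t) (x t) ∂μ = inner ℝ x hF.toLp := fun F hF x => by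
    rw [L2.inner_def, ← integral_indicator hs]
    refine integral_congr_ae ?_
    filter_upwards [hF.coeFn_toLp] with t ht
    rw [ht, real_inner_comm]
    by_cases h : t ∈ s <;> simp [h]
  rw [e _ h0]
  simp only [fun k => e _ (hm k) (w k)]
  exact tendsto_inner_of_weak_of_strong hD hw hstr

theorem integrable_inner_of_bound [IsFiniteMeasure μ] {G : Ω → W} {C : ℝ} (w : Lp W 2 μ)
    (hG : AEStronglyMeasurable G μ) (hC : ∀ᵐ t ∂μ, ‖G t‖ ≤ C) :
    Integrable (fun t => inner ℝ (G t) (w t)) μ := by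
  have hm : MemLp G 2 μ := MemLp.of_bound hG C hC
  refine (L2.integrable_inner (𝕜 := ℝ) hm.toLp w).congr ?_
  filter_upwards [hm.coeFn_toLp] with t ht
  rw [ht]

end L2

/-! ### The periodic shift group -/

section Shift

variable {l : ℝ}

theorem shiftPoint_mem_Ico (hl : 0 < l) (z : ℝ) {x : ℝ} (hx : x ∈ Ico 0 l) :
    shiftPoint l z x ∈ Ico 0 l := by
  have h0 : 0 ≤ shiftMod l z := mul_nonneg (Int.fract_nonneg _) hl.le
  have h1 : shiftMod l z < l := by
    have := Int.fract_lt_one (z / l)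
    unfold shiftMod
    nlinarith
  obtain ⟨hx0, hx1⟩ := hx
  unfold shiftPoint
  split_ifs <;> constructor <;> linarith

theorem exists_sub_eq_shiftPoint_add (hl : 0 < l) (z x : ℝ) :
    ∃ k : ℤ, x - z = shiftPoint l z x + k * l := by
  have h : shiftMod l z = z - ⌊z / l⌋ * l := by
    rw [shiftMod, Int.fract, sub_mul, div_mul_cancel₀ _ hl.ne']
  unfold shiftPoint
  rw [h]
  split_ifs
  · exact ⟨-⌊z / l⌋, by push_cast; ring⟩
  · exact ⟨-⌊z / l⌋ - 1, by push_cast; ring⟩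

theorem eq_of_mem_Ico_of_eq_add_mul {c d : ℝ} (hc : c ∈ Ico 0 l) (hd : d ∈ Ico 0 l)
    {k : ℤ} (h : c = d + k * l) : c = d := by
  have hl : 0 < l := hc.1.trans_lt hc.2
  obtain ⟨hc0, hc1⟩ := hc
  obtain ⟨hd0, hd1⟩ := hd
  have h1 : (k : ℝ) < 1 := by by_contra! hk; nlinarith
  have h2 : (-1 : ℝ) < k := by by_contra! hk; nlinarith
  have h3 : k = 0 := by
    have : k < 1 := by exact_mod_cast h1
    have : -1 < k := by exact_mod_cast h2
    omega
  simpa [h3] using h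

/-- Both sides lie in `[0, l)` and are congruent to `x - z - h` modulo `l`. -/
theorem shiftPoint_shiftPoint (hl : 0 < l) (z h : ℝ) {x : ℝ} (hx : x ∈ Ico 0 l) :
    shiftPoint l h (shiftPoint l z x) = shiftPoint l (z + h) x := by
  obtain ⟨i, hi⟩ := exists_sub_eq_shiftPoint_add hl z x
  obtain ⟨j, hj⟩ := exists_sub_eq_shiftPoint_add hl h (shiftPoint l z x)
  obtain ⟨k, hk⟩ := exists_sub_eq_shiftPoint_add hl (z + h) x
  refine eq_of_mem_Ico_of_eq_add_mul (k := k - i - j)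
    (shiftPoint_mem_Ico hl _ (shiftPoint_mem_Ico hl _ hx)) (shiftPoint_mem_Ico hl _ hx) ?_
  push_cast
  linarith

theorem coeFn_shift (z : ℝ) (f : H l) :
    shift l z f =ᵐ[volume.restrict (Ioo 0 l)] fun x => f (shiftPoint l z x) :=
  Lp.coeFn_compMeasurePreserving f (measurePreserving_shiftPoint l z)

theorem shift_shift (hl : 0 < l) (z h : ℝ) (f : H l) :
    shift l z (shift l h f) = shift l (z + h) f := by
  refine Lp.ext ?_
  filter_upwards [coeFn_shift z (shift l h f), coeFn_shift (z + h) f,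
    (measurePreserving_shiftPoint l z).quasiMeasurePreserving.ae (coeFn_shift h f),
    ae_restrict_mem measurableSet_Ioo] with x h1 h2 h3 hx
  rw [h1, h2, h3, shiftPoint_shiftPoint hl z h (Ioo_subset_Ico_self hx)]

theorem norm_shift (z : ℝ) (f : H l) : ‖shift l z f‖ = ‖f‖ :=
  (Lp.compMeasurePreservingₗᵢ ℝ (shiftPoint l z) (measurePreserving_shiftPoint l z)).norm_map f

/-- The periodic shift group is strongly continuous. -/
theorem continuous_shift (hl : 0 < l) (f : H l) : Continuous fun z => shift l z f := by
  have : Fact (0 < l) := ⟨hl⟩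
  have hIoc : volume.restrict (Ioc (0 : ℝ) (0 + l)) = volume.restrict (Ioo 0 l) := by
    rw [zero_add, Measure.restrict_congr_set Ioo_ae_eq_Ioc]
  have hπ : MeasurePreserving ((↑) : ℝ → AddCircle l) (volume.restrict (Ioo 0 l)) volume := by
    rw [← hIoc]
    exact AddCircle.measurePreserving_mk l 0
  let e : AddCircle l → ℝ := fun c => (AddCircle.measurableEquivIoc l 0 c : ℝ)
  have he : MeasurePreserving e volume (volume.restrict (Ioo 0 l)) := by
    rw [← hIoc]
    exact (measurePreserving_subtype_coe measurableSet_Ioc).comp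
      (AddCircle.measurePreserving_equivIoc l)
  -- On the circle the shift is composition with a rotation, which depends continuously on `z` as a
  -- continuous map, unlike `shiftPoint` with its jump. Continuity is proved there and pulled back
  -- along `hπ`.
  let τ : ℝ → C(AddCircle l, AddCircle l) := fun z => ⟨fun c => c + ((-z : ℝ) : AddCircle l),
    by fun_prop⟩
  have hτ : ∀ z, MeasurePreserving (τ z) volume volume := fun z =>
    measurePreserving_add_right volume _
  have hτc : Continuous τ := by
    refine ContinuousMap.continuous_of_continuous_uncurry _ ?_
    change Continuous fun p : ℝ × AddCircle l => p.2 + ((-p.1 : ℝ) : AddCircle l)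
    have : Continuous fun p : ℝ × AddCircle l => ((-p.1 : ℝ) : AddCircle l) :=
      (AddCircle.continuous_mk' l).comp continuous_fst.neg
    exact continuous_snd.add this
  have hmid : Continuous fun z => Lp.compMeasurePreserving (τ z) (hτ z)
      (Lp.compMeasurePreserving e he f) :=
    continuous_const.compMeasurePreservingLp hτc hτ (by simp)
  have hfin := (Lp.isometry_compMeasurePreserving (E := ℝ) (p := 2) hπ).continuous.comp hmid
  refine hfin.congr fun z => Lp.ext ?_
  have a1 := Lp.coeFn_compMeasurePreserving (Lp.compMeasurePreserving (τ z) (hτ z)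
      (Lp.compMeasurePreserving e he f)) hπ
  have a2 := hπ.quasiMeasurePreserving.ae (Lp.coeFn_compMeasurePreserving
    (Lp.compMeasurePreserving e he f) (hτ z))
  have a3 := hπ.quasiMeasurePreserving.ae ((hτ z).quasiMeasurePreserving.ae
    (Lp.coeFn_compMeasurePreserving f he))
  -- At this one point `shiftPoint` is `0`, whereas the circle representative in `(0, l]` is `l`; it
  -- is discarded as a null set.
  have a4 : ∀ᵐ x ∂(volume.restrict (Ioo 0 l)), x ≠ shiftMod l z :=
    ae_restrict_of_ae (by simp [ae_iff, measure_singleton])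
  filter_upwards [a1, a2, a3, a4, coeFn_shift z f, ae_restrict_mem measurableSet_Ioo]
    with x h1 h2 h3 h4 h5 hx
  simp only [Function.comp_apply] at h1 h2 h3 ⊢
  rw [h1, h2, h3, h5]
  congr 1
  have hmem := shiftPoint_mem_Ico hl z (Ioo_subset_Ico_self hx)
  have hne : shiftPoint l z x ≠ 0 := by
    have h1 : shiftMod l z < l := by
      have := Int.fract_lt_one (z / l)
      unfold shiftMod
      nlinarith
    unfold shiftPoint
    split_ifs
    · exact sub_ne_zero.2 h4
    · have := hx.1
      exact (by linarith : (0 : ℝ) < x - shiftMod l z + l).ne'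
  obtain ⟨k, hk⟩ := exists_sub_eq_shiftPoint_add hl z x
  have hcoe : τ z (x : AddCircle l) = ((shiftPoint l z x : ℝ) : AddCircle l) := by
    change (x : AddCircle l) + ((-z : ℝ) : AddCircle l) = _
    rw [← AddCircle.coe_add, ← sub_eq_add_neg, hk, AddCircle.coe_add]
    have : ((k * l : ℝ) : AddCircle l) = 0 := by
      rw [AddCircle.coe_eq_zero_iff]
      exact ⟨k, by simp⟩
    rw [this, add_zero]
  rw [hcoe]
  exact AddCircle.equivIoc_coe_of_mem (p := l) (a := 0)
    ⟨lt_of_le_of_ne hmem.1 hne.symm, by simpa using hmem.2.le⟩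

/-- By the group property, the derivative of the shift at `z` is the shift of its derivative at `0`;
both exist or neither does. -/
theorem shiftDeriv_eq_shift (hl : 0 < l) (z : ℝ) (f : H l) :
    shiftDeriv l z f = shift l z (shiftDeriv l 0 f) := by
  -- The bounded operator `𝒯(w)` carries a derivative at `z` to one at `w + z`, since `𝒯(w) 𝒯(ζ - w)
  -- = 𝒯(ζ)`.
  have key : ∀ z w : ℝ, DifferentiableAt ℝ (fun ζ => shift l ζ f) z →
      HasDerivAt (fun ζ => shift l ζ f) (shift l w (shiftDeriv l z f)) (w + z) := by
    intro z w h
    have h1 : HasDerivAt (fun ζ => shift l (ζ - w) f) (shiftDeriv l z f) (w + z) := by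
      have h2 : HasDerivAt (fun ζ => shift l ζ f) (shiftDeriv l z f) (w + z - w) := by
        rw [add_sub_cancel_left]
        exact h.hasDerivAt
      exact h2.comp_sub_const (w + z) w
    have h2 := (shift l w).hasFDerivAt.comp_hasDerivAt (w + z) h1
    refine h2.congr_of_eventuallyEq (Eventually.of_forall fun ζ => ?_)
    simp only [Function.comp_apply]
    rw [shift_shift hl, add_sub_cancel]
  by_cases h : DifferentiableAt ℝ (fun ζ => shift l ζ f) 0
  · simpa [shiftDeriv] using (key 0 z h).deriv
  -- Without differentiability both sides are the default value `0` of `deriv`, so the identity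
  -- holds for every `f` in `H`.
  · have h' : ¬ DifferentiableAt ℝ (fun ζ => shift l ζ f) z := fun hz => h <| by
      simpa using (key z (-z) hz).differentiableAt
    rw [shiftDeriv, shiftDeriv, deriv_zero_of_not_differentiableAt h,
      deriv_zero_of_not_differentiableAt h', map_zero]

theorem continuous_shiftDeriv (hl : 0 < l) (f : H l) : Continuous fun z => shiftDeriv l z f :=
  (continuous_shift hl (shiftDeriv l 0 f)).congr fun z => (shiftDeriv_eq_shift hl z f).symm

theorem norm_shiftDeriv (hl : 0 < l) (z : ℝ) (f : H l) :
    ‖shiftDeriv l z f‖ = ‖shiftDeriv l 0 f‖ := by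
  rw [shiftDeriv_eq_shift hl, norm_shift]

end Shift

/-! ### Linear combinations, turning matrix forms into inner products in `H` -/

section Comb

variable {V : Type*} [NormedAddCommGroup V] [InnerProductSpace ℝ V] {n m : ℕ}

/-- The linear combination `∑ᵢ cᵢ fᵢ` as a linear function of `c`. -/
noncomputable def comb (f : Fin n → V) : EuclideanSpace ℝ (Fin n) →ₗ[ℝ] V where
  toFun c := ∑ i, c i • f i
  map_add' c d := by simp [add_smul, Finset.sum_add_distrib]
  map_smul' r c := by simp [mul_smul, Finset.smul_sum]

theorem comb_apply (f : Fin n → V) (c : EuclideanSpace ℝ (Fin n)) :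
    comb f c = ∑ i, c i • f i := rfl

theorem norm_comb_le (f : Fin n → V) (c : EuclideanSpace ℝ (Fin n)) :
    ‖comb f c‖ ≤ (∑ i, ‖f i‖) * ‖c‖ := by
  rw [comb_apply, Finset.sum_mul]
  refine norm_sum_le_of_le _ fun i _ => ?_
  rw [norm_smul, mul_comm]
  exact mul_le_mul_of_nonneg_left (PiLp.norm_apply_le c i) (norm_nonneg _)

theorem dotProduct_mulVec_inner (f : Fin n → V) (g : Fin m → V)
    (a : EuclideanSpace ℝ (Fin n)) (c : EuclideanSpace ℝ (Fin m)) :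
    a.ofLp ⬝ᵥ ((Matrix.of fun i j => inner ℝ (f i) (g j)) *ᵥ c.ofLp) =
      inner ℝ (comb f a) (comb g c) := by
  simp only [comb_apply, dotProduct, Matrix.mulVec, Matrix.of_apply, sum_inner, inner_sum,
    inner_smul_left, inner_smul_right, Finset.mul_sum]
  rw [Finset.sum_comm]
  exact Finset.sum_congr rfl fun i _ => Finset.sum_congr rfl fun j _ => by
    simp only [conj_trivial]; ring

end Comb

/-! ### The reduced-order model: algebraic identities and the velocity bound -/

section Model

variable {l : ℝ} {n m : ℕ} (φ : Fin n → C1Per l) (b : Fin m → H l)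

theorem controlOp_single (j : Fin m) : controlOp b (EuclideanSpace.single j 1) = b j := by
  simp [controlOp, ite_smul]

theorem dotProduct_matN (a c : EuclideanSpace ℝ (Fin n)) :
    a.ofLp ⬝ᵥ (matN φ *ᵥ c.ofLp) =
      -inner ℝ (comb (fun i => (φ i).toL2) a) (comb (fun i => (φ i).derivL2) c) := by
  rw [← dotProduct_mulVec_inner, ← dotProduct_neg, ← Matrix.neg_mulVec]
  rfl

theorem dotProduct_matN_transpose (a c : EuclideanSpace ℝ (Fin n)) :
    a.ofLp ⬝ᵥ ((matN φ)ᵀ *ᵥ c.ofLp) =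
      -inner ℝ (comb (fun i => (φ i).toL2) c) (comb (fun i => (φ i).derivL2) a) := by
  rw [← dotProduct_matN, Matrix.mulVec_transpose, dotProduct_comm, Matrix.dotProduct_mulVec]

theorem dotProduct_matM2 (a c : EuclideanSpace ℝ (Fin n)) :
    a.ofLp ⬝ᵥ (matM2 φ *ᵥ c.ofLp) =
      inner ℝ (comb (fun i => (φ i).derivL2) a) (comb (fun i => (φ i).derivL2) c) :=
  dotProduct_mulVec_inner _ _ a c

theorem dotProduct_matB1 (z : ℝ) (a : EuclideanSpace ℝ (Fin n)) (u : EuclideanSpace ℝ (Fin m)) :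
    a.ofLp ⬝ᵥ (matB1 φ b z *ᵥ u.ofLp) =
      inner ℝ (comb (fun i => shift l z (φ i).toL2) a) (comb b u) := by
  rw [← dotProduct_mulVec_inner]
  simp only [matB1, controlOp_single]

theorem dotProduct_matB2 (z : ℝ) (a : EuclideanSpace ℝ (Fin n)) (u : EuclideanSpace ℝ (Fin m)) :
    a.ofLp ⬝ᵥ (matB2 φ b z *ᵥ u.ofLp) =
      inner ℝ (comb (fun i => shiftDeriv l z (φ i).toL2) a) (comb b u) := by
  rw [← dotProduct_mulVec_inner]
  simp only [matB2, controlOp_single]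

/-- Integrate `(f g)'` over one period; the boundary values cancel. This is the antisymmetry of `N`.
-/
theorem inner_toL2_derivL2_add (hl : 0 < l) (f g : C1Per l) :
    inner ℝ f.toL2 g.derivL2 + inner ℝ g.toL2 f.derivL2 = 0 := by
  have e : ∀ f g : C1Per l, inner ℝ f.toL2 g.derivL2 =
      ∫ x in (0 : ℝ)..l, f.toFun x * derivWithin g.toFun (Icc 0 l) x := fun f g => by
    rw [L2.inner_def, intervalIntegral.integral_of_le hl.le, integral_Ioc_eq_integral_Ioo]
    refine integral_congr_ae ?_
    filter_upwards [(memLp_of_continuousOn f.contDiffOn.continuousOn).coeFn_toLp,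
      (memLp_of_continuousOn g.continuousOn_deriv).coeFn_toLp] with x h1 h2
    rw [C1Per.toL2, C1Per.derivL2, h1, h2]
    simp [mul_comm]
  have hi : ∀ f g : C1Per l, IntervalIntegrable
      (fun x => f.toFun x * derivWithin g.toFun (Icc 0 l) x) volume 0 l := fun f g => by
    refine ContinuousOn.intervalIntegrable ?_
    rw [uIcc_of_le hl.le]
    exact f.contDiffOn.continuousOn.mul g.continuousOn_deriv
  have hd : ∀ f : C1Per l, ∀ x ∈ Ioo 0 l,
      HasDerivAt f.toFun (derivWithin f.toFun (Icc 0 l) x) x := fun f x hx =>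
    ((f.contDiffOn.differentiableOn one_ne_zero x
      (Ioo_subset_Icc_self hx)).hasDerivWithinAt).hasDerivAt (Icc_mem_nhds hx.1 hx.2)
  rw [e, e, ← intervalIntegral.integral_add (hi f g) (hi g f)]
  have key := intervalIntegral.integral_eq_sub_of_hasDerivAt_of_le hl.le
    (f := fun x => f.toFun x * g.toFun x)
    (f' := fun x => f.toFun x * derivWithin g.toFun (Icc 0 l) x +
      g.toFun x * derivWithin f.toFun (Icc 0 l) x)
    (f.contDiffOn.continuousOn.mul g.contDiffOn.continuousOn)
    (fun x hx => ((hd f x hx).mul (hd g x hx)).congr_deriv (by ring))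
    ((hi f g).add (hi g f))
  rw [key, f.map_eq, g.map_eq, sub_self]

theorem inner_comb_toL2_derivL2 (hl : 0 < l) (c : EuclideanSpace ℝ (Fin n)) :
    inner ℝ (comb (fun i => (φ i).toL2) c) (comb (fun i => (φ i).derivL2) c) = 0 := by
  have e : inner ℝ (comb (fun i => (φ i).toL2) c) (comb (fun i => (φ i).derivL2) c) =
      ∑ i, ∑ j, c i * c j * inner ℝ (φ i).toL2 (φ j).derivL2 := by
    simp only [comb_apply, sum_inner, inner_sum, inner_smul_left, inner_smul_right, conj_trivial,
      Finset.mul_sum]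
    rw [Finset.sum_comm]
    exact Finset.sum_congr rfl fun i _ => Finset.sum_congr rfl fun j _ => by ring
  have e2 := e
  rw [Finset.sum_comm] at e2
  have : (2 : ℝ) *
      inner ℝ (comb (fun i => (φ i).toL2) c) (comb (fun i => (φ i).derivL2) c) = 0 := by
    rw [two_mul]
    nth_rewrite 1 [e]
    rw [e2]
    simp only [← Finset.sum_add_distrib]
    refine Finset.sum_eq_zero fun i _ => Finset.sum_eq_zero fun j _ => ?_
    rw [mul_comm (c j), ← mul_add, inner_toL2_derivL2_add hl, mul_zero]
  linarith

theorem norm_comb_orthonormal {φ : Fin n → C1Per l} (hφ : Orthonormal ℝ fun i => (φ i).toL2)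
    (c : EuclideanSpace ℝ (Fin n)) :
    inner ℝ (comb (fun i => (φ i).toL2) c) (comb (fun i => (φ i).toL2) c) =
      c.ofLp ⬝ᵥ c.ofLp := by
  simp only [comb_apply]
  rw [hφ.inner_sum]
  simp [dotProduct]

/-- Linear independence makes `(x, y) ↦ ∑ xᵢ φᵢ - ∑ yᵢ φᵢ'` injective, and an injective linear map
on a finite-dimensional space is bounded below. The constant depends on no state; with `x = α'`, `y
= z' α` it controls the velocities. -/
theorem exists_norm_le_norm_comb_sub {φ : Fin n → C1Per l}
    (hφ' : LinearIndependent ℝ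
      (Sum.elim (fun i => (φ i).toL2) (fun i => (φ i).derivL2) : Fin n ⊕ Fin n → H l)) :
    ∃ K : ℝ, 0 ≤ K ∧ ∀ x y : EuclideanSpace ℝ (Fin n),
      ‖x‖ ≤ K * ‖comb (fun i => (φ i).toL2) x - comb (fun i => (φ i).derivL2) y‖ ∧
      ‖y‖ ≤ K * ‖comb (fun i => (φ i).toL2) x - comb (fun i => (φ i).derivL2) y‖ := by
  let L : EuclideanSpace ℝ (Fin n) × EuclideanSpace ℝ (Fin n) →ₗ[ℝ] H l :=
    (comb fun i => (φ i).toL2).coprod (-comb fun i => (φ i).derivL2)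
  have hL : LinearMap.ker L = ⊥ := by
    rw [LinearMap.ker_eq_bot']
    rintro ⟨x, y⟩ hxy
    have h := Fintype.linearIndependent_iff.1 hφ' (Sum.elim x.ofLp (-y.ofLp)) (by
      simpa [L, comb_apply, Fintype.sum_sum_type, sub_eq_add_neg] using hxy)
    ext i
    · simpa using h (Sum.inl i)
    · simpa using h (Sum.inr i)
  obtain ⟨K, -, hK⟩ := L.exists_antilipschitzWith hL
  refine ⟨K, K.2, fun x y => ?_⟩
  have h : ‖(x, y)‖ ≤ K * ‖L (x, y)‖ := by
    simpa using hK.le_mul_dist (x, y) 0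
  have hL2 : L (x, y) = comb (fun i => (φ i).toL2) x - comb (fun i => (φ i).derivL2) y := by
    simp [L, sub_eq_add_neg]
  rw [hL2] at h
  exact ⟨(norm_fst_le (x, y)).trans h, (norm_snd_le (x, y)).trans h⟩

theorem le_add_mul_one_add_of_mul_self_le {x y B D : ℝ} (hx : 0 ≤ x) (hy : 0 ≤ y) (hB : 0 ≤ B)
    (hD : 0 ≤ D) (h : x * x ≤ x * (B + D * y)) : x ≤ (B + D) * (1 + y) := by
  have h1 : B + D * y ≤ (B + D) * (1 + y) := by
    have := mul_nonneg hB hy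
    linarith
  rcases hx.eq_or_lt with h0 | h0
  · rw [← h0]; positivity
  · exact (le_of_mul_le_mul_left h h0).trans h1

/-- The mass matrix is a Gram matrix: testing the two rows with the velocities. -/
theorem sq_norm_velocity_eq {φ : Fin n → C1Per l} (hφ : Orthonormal ℝ fun i => (φ i).toL2)
    {v : ℝ} {a a' : EuclideanSpace ℝ (Fin n)} {z z' : ℝ} {u : EuclideanSpace ℝ (Fin m)}
    (h1 : a'.ofLp + z' • (matN φ *ᵥ a.ofLp) =
      v • (matN φ *ᵥ a.ofLp) + matB1 φ b z *ᵥ u.ofLp)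
    (h2 : a.ofLp ⬝ᵥ ((matN φ)ᵀ *ᵥ a'.ofLp) + (a.ofLp ⬝ᵥ (matM2 φ *ᵥ a.ofLp)) * z' =
      v * (a.ofLp ⬝ᵥ (matM2 φ *ᵥ a.ofLp)) + a.ofLp ⬝ᵥ (matB2 φ b z *ᵥ u.ofLp)) :
    ‖comb (fun i => (φ i).toL2) a' - comb (fun i => (φ i).derivL2) (z' • a)‖ ^ 2 =
      -v * inner ℝ (comb (fun i => (φ i).toL2) a' - comb (fun i => (φ i).derivL2) (z' • a))
          (comb (fun i => (φ i).derivL2) a) +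
      inner ℝ (comb (fun i => shift l z (φ i).toL2) a') (comb b u) +
      inner ℝ (comb (fun i => shiftDeriv l z (φ i).toL2) (z' • a)) (comb b u) := by
  have h1' := congrArg (fun w => a'.ofLp ⬝ᵥ w) h1
  simp only [dotProduct_add, dotProduct_smul, smul_eq_mul, dotProduct_matN, dotProduct_matB1,
    ← norm_comb_orthonormal hφ] at h1'
  rw [dotProduct_matN_transpose, dotProduct_matM2, dotProduct_matB2] at h2
  rw [← real_inner_self_eq_norm_sq]
  simp only [map_smul, inner_sub_left, inner_sub_right, inner_smul_left, inner_smul_right,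
    conj_trivial]
  rw [real_inner_comm (comb (fun i => (φ i).toL2) a') (comb (fun i => (φ i).derivL2) a)]
  linear_combination h1' + z' * h2

/-- The velocities are controlled as long as `α` stays bounded and bounded away from zero. -/
theorem exists_velocity_bound (hl : 0 < l) {φ : Fin n → C1Per l}
    (hφ : Orthonormal ℝ fun i => (φ i).toL2)
    (hφ' : LinearIndependent ℝ
      (Sum.elim (fun i => (φ i).toL2) (fun i => (φ i).derivL2) : Fin n ⊕ Fin n → H l))
    (v : ℝ) {r : ℝ} (hr : 0 < r) :
    ∃ K : ℝ, 0 ≤ K ∧ ∀ (a a' : EuclideanSpace ℝ (Fin n)) (z z' : ℝ) (u : EuclideanSpace ℝ (Fin m)),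
      r / 2 ≤ ‖a‖ → ‖a‖ ≤ 2 * r →
      a'.ofLp + z' • (matN φ *ᵥ a.ofLp) = v • (matN φ *ᵥ a.ofLp) + matB1 φ b z *ᵥ u.ofLp →
      a.ofLp ⬝ᵥ ((matN φ)ᵀ *ᵥ a'.ofLp) + (a.ofLp ⬝ᵥ (matM2 φ *ᵥ a.ofLp)) * z' =
        v * (a.ofLp ⬝ᵥ (matM2 φ *ᵥ a.ofLp)) + a.ofLp ⬝ᵥ (matB2 φ b z *ᵥ u.ofLp) →
      ‖a'‖ ≤ K * (1 + ‖u‖) ∧ |z'| ≤ K * (1 + ‖u‖) := by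
  obtain ⟨K₀, hK₀, hK⟩ := exists_norm_le_norm_comb_sub hφ'
  obtain ⟨C₁, p1, n1⟩ : ∃ C, 0 ≤ C ∧ ∀ z x, ‖comb (fun i => shift l z (φ i).toL2) x‖ ≤ C * ‖x‖ :=
    ⟨∑ i, ‖(φ i).toL2‖, Finset.sum_nonneg fun _ _ => norm_nonneg _, fun z x => by
      simpa only [norm_shift] using norm_comb_le (fun i => shift l z (φ i).toL2) x⟩
  obtain ⟨C₂, p2, n2⟩ :
      ∃ C, 0 ≤ C ∧ ∀ z x, ‖comb (fun i => shiftDeriv l z (φ i).toL2) x‖ ≤ C * ‖x‖ :=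
    ⟨∑ i, ‖shiftDeriv l 0 (φ i).toL2‖, Finset.sum_nonneg fun _ _ => norm_nonneg _, fun z x => by
      have := norm_comb_le (fun i => shiftDeriv l z (φ i).toL2) x
      simpa only [norm_shiftDeriv hl z] using this⟩
  obtain ⟨C₃, p3, n3⟩ : ∃ C, 0 ≤ C ∧ ∀ x, ‖comb (fun i => (φ i).derivL2) x‖ ≤ C * ‖x‖ :=
    ⟨_, Finset.sum_nonneg fun _ _ => norm_nonneg _, norm_comb_le _⟩
  obtain ⟨Cb, pb, nb⟩ : ∃ C, 0 ≤ C ∧ ∀ x, ‖comb b x‖ ≤ C * ‖x‖ :=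
    ⟨_, Finset.sum_nonneg fun _ _ => norm_nonneg _, norm_comb_le _⟩
  obtain ⟨A, hA⟩ : ∃ A, A = |v| * (C₃ * (2 * r)) + K₀ * (C₁ + C₂) * Cb := ⟨_, rfl⟩
  have hA0 : 0 ≤ A := by rw [hA]; positivity
  -- `K₀ * A` serves for `a'`; the factor `2 / r` comes from dividing `z' • a` by `‖a‖ ≥ r / 2`.
  refine ⟨K₀ * A * (1 + 2 / r), by positivity, ?_⟩
  intro a a' z z' u ha ha2 h1 h2
  obtain ⟨k1, k2⟩ := hK a' (z' • a)
  have hid := sq_norm_velocity_eq b hφ h1 h2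
  -- As `a'` and `z' • a` are both at most `K₀ * ‖F‖`, the right side of `hid` is at most linear in
  -- `‖F‖`, and one factor `‖F‖` cancels.
  generalize comb (fun i => (φ i).toL2) a' - comb (fun i => (φ i).derivL2) (z' • a) = F
    at k1 k2 hid
  have hu := norm_nonneg u
  have b1 : -v * inner ℝ F (comb (fun i => (φ i).derivL2) a) ≤ |v| * (‖F‖ * (C₃ * (2 * r))) := by
    refine (le_abs_self _).trans ?_
    rw [abs_mul, abs_neg]
    exact mul_le_mul_of_nonneg_left ((abs_real_inner_le_norm _ _).trans
      (mul_le_mul_of_nonneg_left ((n3 a).trans (mul_le_mul_of_nonneg_left ha2 p3))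
        (norm_nonneg _))) (abs_nonneg _)
  have b2 : inner ℝ (comb (fun i => shift l z (φ i).toL2) a') (comb b u) ≤
      C₁ * (K₀ * ‖F‖) * (Cb * ‖u‖) :=
    (real_inner_le_norm _ _).trans (mul_le_mul
      ((n1 z a').trans (mul_le_mul_of_nonneg_left k1 p1)) (nb u) (norm_nonneg _) (by positivity))
  have b3 : inner ℝ (comb (fun i => shiftDeriv l z (φ i).toL2) (z' • a)) (comb b u) ≤
      C₂ * (K₀ * ‖F‖) * (Cb * ‖u‖) :=
    (real_inner_le_norm _ _).trans (mul_le_mul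
      ((n2 z _).trans (mul_le_mul_of_nonneg_left k2 p2)) (nb u) (norm_nonneg _) (by positivity))
  have hFA : ‖F‖ ≤ A * (1 + ‖u‖) := by
    rw [hA]
    refine le_add_mul_one_add_of_mul_self_le (norm_nonneg _) hu (by positivity) (by positivity) ?_
    rw [← sq, hid]
    linarith
  have hKF : K₀ * ‖F‖ ≤ K₀ * (A * (1 + ‖u‖)) := mul_le_mul_of_nonneg_left hFA hK₀
  have hK1 : 0 ≤ K₀ * A * (1 + ‖u‖) := by positivity
  have hr2 : 0 < 2 / r := by positivity
  have hK2 : 0 ≤ K₀ * A * (1 + ‖u‖) * (2 / r) := by positivity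
  constructor
  · linarith
  · have k3 : |z'| * (r / 2) ≤ K₀ * (A * (1 + ‖u‖)) := by
      calc |z'| * (r / 2) ≤ |z'| * ‖a‖ := mul_le_mul_of_nonneg_left ha (abs_nonneg _)
        _ = ‖z' • a‖ := by rw [norm_smul, Real.norm_eq_abs]
        _ ≤ K₀ * (A * (1 + ‖u‖)) := k2.trans hKF
    have k4 := mul_le_mul_of_nonneg_right k3 hr2.le
    have k5 : |z'| * (r / 2) * (2 / r) = |z'| := by field_simp
    linarith

end Model

/-! ### A priori bounds for small controls -/

section Estimates

/-- Young's inequality `‖u t‖ ≤ δ / 2 + ‖u t‖² / (2 δ)`, integrated; this avoids the square root of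
Cauchy–Schwarz. -/
theorem integral_norm_le_of_norm_le {W : Type} [NormedAddCommGroup W] [InnerProductSpace ℝ W]
    {T δ : ℝ} (hT : 0 ≤ T) (hδ : 0 < δ) {u : L2 0 T W} (hu : ‖u‖ ≤ δ) :
    ∫ t in (0 : ℝ)..T, ‖u t‖ ≤ δ * (T + 1) / 2 := by
  rw [intervalIntegral.integral_of_le hT, integral_Ioc_eq_integral_Ioo]
  have hi : Integrable (fun t => ‖u t‖ ^ 2) (volume.restrict (Ioo 0 T)) :=
    (Lp.memLp u).integrable_norm_pow two_ne_zero
  have h1 : ∫ t in Ioo 0 T, ‖u t‖ ≤ ∫ t in Ioo 0 T, (δ / 2 + ‖u t‖ ^ 2 * (1 / (2 * δ))) := by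
    refine integral_mono ((Lp.memLp u).integrable one_le_two).norm
      ((integrable_const _).add (hi.mul_const _)) fun t => ?_
    have e : δ / 2 + ‖u t‖ ^ 2 * (1 / (2 * δ)) - ‖u t‖ = (‖u t‖ - δ) ^ 2 * (1 / (2 * δ)) := by
      field_simp
      ring
    have : 0 ≤ (‖u t‖ - δ) ^ 2 * (1 / (2 * δ)) := by positivity
    change ‖u t‖ ≤ δ / 2 + ‖u t‖ ^ 2 * (1 / (2 * δ))
    linarith
  rw [integral_add (integrable_const _) (hi.mul_const _), integral_mul_const,
    ← norm_sq_eq_integral] at h1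
  have h2 : ‖u‖ ^ 2 * (1 / (2 * δ)) ≤ δ ^ 2 * (1 / (2 * δ)) := by gcongr
  have h3 : δ ^ 2 * (1 / (2 * δ)) = δ / 2 := by field_simp
  have h4 : ∫ _ in Ioo 0 T, δ / 2 = T * (δ / 2) := by simp [hT]
  linarith

theorem exists_memLp_of_norm_le {W W' : Type} [NormedAddCommGroup W] [InnerProductSpace ℝ W]
    [NormedAddCommGroup W'] [InnerProductSpace ℝ W'] {T δ K : ℝ} (hT : 0 ≤ T)
    {u : L2 0 T W} (hu : ‖u‖ ≤ δ) {f : ℝ → W'}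
    (hf : AEStronglyMeasurable f (volume.restrict (Ioo 0 T)))
    (hfu : ∀ᵐ t ∂volume.restrict (Ioo 0 T), ‖f t‖ ≤ K * (1 + ‖u t‖)) :
    ∃ h : MemLp f 2 (volume.restrict (Ioo 0 T)), ‖h.toLp‖ ≤ √(2 * K ^ 2 * (T + δ ^ 2)) := by
  have hg : MemLp (fun t => K * (1 + ‖u t‖)) 2 (volume.restrict (Ioo 0 T)) :=
    ((memLp_const (1 : ℝ)).add (Lp.memLp u).norm).const_mul K
  have h : MemLp f 2 (volume.restrict (Ioo 0 T)) := hg.of_le hf <| by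
    filter_upwards [hfu] with t ht
    exact ht.trans (le_abs_self _)
  refine ⟨h, Real.le_sqrt_of_sq_le ?_⟩
  have hi : Integrable (fun t => ‖u t‖ ^ 2) (volume.restrict (Ioo 0 T)) :=
    (Lp.memLp u).integrable_norm_pow two_ne_zero
  have h1 : ‖h.toLp‖ ^ 2 ≤ ∫ t in Ioo 0 T, 2 * K ^ 2 * (1 + ‖u t‖ ^ 2) := by
    rw [norm_sq_eq_integral]
    refine integral_mono_ae ((Lp.memLp _).integrable_norm_pow two_ne_zero)
      (((integrable_const _).add hi).const_mul _) ?_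
    filter_upwards [hfu, h.coeFn_toLp] with t h1 h2
    rw [h2]
    calc ‖f t‖ ^ 2 ≤ (K * (1 + ‖u t‖)) ^ 2 := by gcongr
      _ = 2 * K ^ 2 * (1 + ‖u t‖ ^ 2) - (K * (1 - ‖u t‖)) ^ 2 := by ring
      _ ≤ _ := sub_le_self _ (sq_nonneg _)
  rw [integral_const_mul, integral_add (integrable_const _) hi, ← norm_sq_eq_integral] at h1
  have h4 : ∫ _ in Ioo 0 T, (1 : ℝ) = T := by simp [hT]
  rw [h4] at h1
  exact h1.trans (by gcongr)

variable {l T v : ℝ} {n m : ℕ} {φ : Fin n → C1Per l} {b : Fin m → H l}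
  {α₀ : EuclideanSpace ℝ (Fin n)} {z₀ : ℝ} {u : L2 0 T (EuclideanSpace ℝ (Fin m))}
  {α : ℝ → EuclideanSpace ℝ (Fin n)} {z : ℝ → ℝ}

theorem absolutelyContinuousOnInterval_norm_sq {E : Type*} [NormedAddCommGroup E] {f : ℝ → E}
    {a b : ℝ} (hf : AbsolutelyContinuousOnInterval f a b) :
    AbsolutelyContinuousOnInterval (fun t => ‖f t‖ ^ 2) a b := by
  have h : AbsolutelyContinuousOnInterval (fun t => ‖f t‖) a b :=
    absolutelyContinuousOnInterval_of_dist_le (C := 1) hf fun s _ t _ => by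
      rw [one_mul, dist_eq_norm, dist_eq_norm]
      exact abs_norm_sub_norm_le _ _
  simpa only [sq] using! h.mul h

/-- Energy identity: the first row tested with `α`, where antisymmetry of `N` removes both the
transport term and the unknown `z'`. -/
theorem IsState.ae_inner_deriv (hl : 0 < l) (hs : IsState T v φ b α₀ z₀ u α z) :
    ∀ᵐ t ∂volume.restrict (Ioo 0 T), inner ℝ (α t) (deriv α t) =
      inner ℝ (comb (fun i => shift l (z t) (φ i).toL2) (α t)) (comb b (u t)) := by
  filter_upwards [hs.row_one] with t ht
  have h := congrArg (fun w => (α t).ofLp ⬝ᵥ w) ht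
  simp only [dotProduct_add, dotProduct_smul, dotProduct_matN, dotProduct_matB1,
    inner_comb_toL2_derivL2 φ hl, neg_zero, smul_zero, add_zero, zero_add] at h
  rw [← h, EuclideanSpace.inner_eq_star_dotProduct, dotProduct_comm]
  rfl

theorem IsState.abs_norm_sq_sub_le (hl : 0 < l) (hT : 0 ≤ T)
    (hs : IsState T v φ b α₀ z₀ u α z) {D M : ℝ} (hD : 0 ≤ D)
    (hDb : ∀ z (x : EuclideanSpace ℝ (Fin n)) (y : EuclideanSpace ℝ (Fin m)),
      |inner ℝ (comb (fun i => shift l z (φ i).toL2) x) (comb b y)| ≤ D * ‖x‖ * ‖y‖)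
    (hM : ∀ t ∈ Icc 0 T, ‖α t‖ ≤ M) {t : ℝ} (ht : t ∈ Icc 0 T) :
    |‖α t‖ ^ 2 - ‖α₀‖ ^ 2| ≤ 2 * M * (D * ∫ s in (0 : ℝ)..T, ‖u s‖) := by
  have hM0 : 0 ≤ M := (norm_nonneg _).trans (hM t ht)
  have hui : IntervalIntegrable (fun s => 2 * M * (D * ‖u s‖)) volume 0 T :=
    ((intervalIntegrable_of_memLp hT (Lp.memLp u)).norm.const_mul D).const_mul (2 * M)
  have hsub : uIcc 0 t ⊆ uIcc 0 T := uIcc_subset_uIcc_left (by rwa [uIcc_of_le hT])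
  have hac := (absolutelyContinuousOnInterval_norm_sq hs.ac_alpha).mono hsub
  have hae : ∀ᵐ s, s ∈ Ioc 0 t → ‖deriv (fun t => ‖α t‖ ^ 2) s‖ ≤ 2 * M * (D * ‖u s‖) := by
    have h1 : ∀ᵐ s, s ∈ Ioc 0 T → inner ℝ (α s) (deriv α s) =
        inner ℝ (comb (fun i => shift l (z s) (φ i).toL2) (α s)) (comb b (u s)) := by
      rw [← ae_restrict_iff' measurableSet_Ioc, ← Measure.restrict_congr_set Ioo_ae_eq_Ioc]
      exact hs.ae_inner_deriv hl
    filter_upwards [h1, hs.ac_alpha.boundedVariationOn.ae_differentiableAt_of_mem_uIcc]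
      with s e1 e2 hst
    have hsT : s ∈ Ioc 0 T := ⟨hst.1, hst.2.trans ht.2⟩
    have hsT' : s ∈ Icc 0 T := Ioc_subset_Icc_self hsT
    rw [((e2 (by rwa [uIcc_of_le hT])).hasDerivAt.norm_sq).deriv, e1 hsT, norm_mul,
      Real.norm_eq_abs, Real.norm_eq_abs, abs_two, mul_assoc]
    refine mul_le_mul_of_nonneg_left ?_ zero_le_two
    calc _ ≤ D * ‖α s‖ * ‖u s‖ := hDb _ _ _
      _ ≤ D * M * ‖u s‖ := by gcongr; exact hM s hsT'
      _ = M * (D * ‖u s‖) := by ring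
  have key := hac.integral_deriv_eq_sub
  have hb := intervalIntegral.norm_integral_le_of_norm_le ht.1 hae (hui.mono_set hsub)
  rw [key, hs.init_alpha, Real.norm_eq_abs] at hb
  refine hb.trans ?_
  rw [← intervalIntegral.integral_const_mul, ← intervalIntegral.integral_const_mul]
  refine intervalIntegral.integral_mono_interval le_rfl ht.1 ht.2 ?_ hui
  exact Eventually.of_forall fun s => by change 0 ≤ _; positivity

/-- With `r = ‖α₀‖` and `M` the maximum of `‖α‖`, the energy estimate gives `M² ≤ r² + M r / 4`, so
`M ≤ 2 r`. Reinserting `2 r` for `M` gives `‖α t‖² ≥ r² / 2`. -/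
theorem IsState.norm_alpha_mem_Icc (hl : 0 < l) (hT : 0 ≤ T) (hα₀ : α₀ ≠ 0)
    (hs : IsState T v φ b α₀ z₀ u α z) {D : ℝ} (hD : 0 ≤ D)
    (hDb : ∀ z (x : EuclideanSpace ℝ (Fin n)) (y : EuclideanSpace ℝ (Fin m)),
      |inner ℝ (comb (fun i => shift l z (φ i).toL2) x) (comb b y)| ≤ D * ‖x‖ * ‖y‖)
    (hu : D * (∫ s in (0 : ℝ)..T, ‖u s‖) ≤ ‖α₀‖ / 8) {t : ℝ} (ht : t ∈ Icc 0 T) :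
    ‖α t‖ ∈ Icc (‖α₀‖ / 2) (2 * ‖α₀‖) := by
  have hr : 0 < ‖α₀‖ := norm_pos_iff.2 hα₀
  have hc : ContinuousOn (fun t => ‖α t‖) (Icc 0 T) := by
    simpa [uIcc_of_le hT] using hs.ac_alpha.continuousOn.norm
  obtain ⟨t₀, ht₀, hmax⟩ := isCompact_Icc.exists_isMaxOn ⟨t, ht⟩ hc
  have hM : ∀ t ∈ Icc 0 T, ‖α t‖ ≤ ‖α t₀‖ := fun t ht => hmax ht
  set I := D * ∫ s in (0 : ℝ)..T, ‖u s‖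
  have hM2 : ‖α t₀‖ ≤ 2 * ‖α₀‖ := by
    have h := (abs_le.1 (hs.abs_norm_sq_sub_le hl hT hD hDb hM ht₀)).2
    have h2 : 2 * ‖α t₀‖ * I ≤ 2 * ‖α t₀‖ * (‖α₀‖ / 8) := by gcongr
    by_contra! hlt
    nlinarith
  refine ⟨?_, (hM t ht).trans hM2⟩
  have h := (abs_le.1 (hs.abs_norm_sq_sub_le hl hT hD hDb (fun t ht => (hM t ht).trans hM2) ht)).1
  have h2 : 2 * (2 * ‖α₀‖) * I ≤ 2 * (2 * ‖α₀‖) * (‖α₀‖ / 8) := by gcongr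
  by_contra! hlt
  nlinarith [norm_nonneg (α t)]

/-- Integral representation and uniform bounds for the states of small controls. -/
theorem exists_uniform_bounds (hl : 0 < l) (hT : 0 ≤ T)
    (hφ : Orthonormal ℝ fun i => (φ i).toL2)
    (hφ' : LinearIndependent ℝ
      (Sum.elim (fun i => (φ i).toL2) (fun i => (φ i).derivL2) : Fin n ⊕ Fin n → H l))
    (v : ℝ) (b : Fin m → H l) (hα₀ : α₀ ≠ 0) (z₀ : ℝ) :
    ∃ δ > 0, ∃ R : ℝ, ∀ (u : L2 0 T (EuclideanSpace ℝ (Fin m)))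
      (α : ℝ → EuclideanSpace ℝ (Fin n)) (z : ℝ → ℝ),
      IsState T v φ b α₀ z₀ u α z → ‖u‖ ≤ δ →
      (∀ t ∈ Icc 0 T, ‖α t‖ ≤ R ∧ ‖z t‖ ≤ R) ∧
      ∃ (a : L2 0 T (EuclideanSpace ℝ (Fin n))) (c : L2 0 T ℝ),
        a =ᵐ[volume.restrict (Ioo 0 T)] deriv α ∧ c =ᵐ[volume.restrict (Ioo 0 T)] deriv z ∧
        ‖a‖ ≤ R ∧ ‖c‖ ≤ R ∧
        ∀ t ∈ Icc 0 T, α t = α₀ + ∫ s in (0 : ℝ)..t, a s ∧ z t = z₀ + ∫ s in (0 : ℝ)..t, c s := by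
  have hr : 0 < ‖α₀‖ := norm_pos_iff.2 hα₀
  obtain ⟨K, hK, hvel⟩ := exists_velocity_bound b hl hφ hφ' v hr
  set D := (∑ i, ‖(φ i).toL2‖) * ∑ j, ‖b j‖ with hDdef
  have hD : 0 ≤ D := by positivity
  have hDb : ∀ z (x : EuclideanSpace ℝ (Fin n)) (y : EuclideanSpace ℝ (Fin m)),
      |inner ℝ (comb (fun i => shift l z (φ i).toL2) x) (comb b y)| ≤ D * ‖x‖ * ‖y‖ := by
    intro z x y
    have h1 : ‖comb (fun i => shift l z (φ i).toL2) x‖ ≤ (∑ i, ‖(φ i).toL2‖) * ‖x‖ := by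
      simpa only [norm_shift] using norm_comb_le (fun i => shift l z (φ i).toL2) x
    refine (abs_real_inner_le_norm _ _).trans
      ((mul_le_mul h1 (norm_comb_le b y) (norm_nonneg _) (by positivity)).trans_eq ?_)
    rw [hDdef]
    ring
  -- Chosen so that `D * ∫ ‖u‖ ≤ D * (δ * (T + 1) / 2) ≤ ‖α₀‖ / 8`; `D + 1` guards against `D = 0`.
  set δ := ‖α₀‖ / (4 * (D + 1) * (T + 1)) with hδdef
  have hδ : 0 < δ := by positivity
  have hδ8 : D * (δ * (T + 1) / 2) ≤ ‖α₀‖ / 8 := by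
    have e : (D + 1) * (δ * (T + 1) / 2) = ‖α₀‖ / 8 := by
      rw [hδdef]
      field_simp
      norm_num
    have : 0 ≤ δ * (T + 1) / 2 := by positivity
    linarith
  set R₁ := √(2 * K ^ 2 * (T + δ ^ 2))
  have hR₁ : 0 ≤ R₁ := Real.sqrt_nonneg _
  refine ⟨δ, hδ, 2 * ‖α₀‖ + |z₀| + (R₁ + 1) * (T + 1), ?_⟩
  intro u α z hs hu
  have hmem : ∀ t ∈ Icc 0 T, ‖α t‖ ∈ Icc (‖α₀‖ / 2) (2 * ‖α₀‖) := fun t ht =>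
    hs.norm_alpha_mem_Icc hl hT hα₀ hD hDb
      ((mul_le_mul_of_nonneg_left (integral_norm_le_of_norm_le hT hδ hu) hD).trans hδ8) ht
  have hv : ∀ᵐ t ∂volume.restrict (Ioo 0 T),
      ‖deriv α t‖ ≤ K * (1 + ‖u t‖) ∧ |deriv z t| ≤ K * (1 + ‖u t‖) := by
    filter_upwards [hs.row_one, hs.row_two, ae_restrict_mem measurableSet_Ioo] with t h1 h2 ht
    have h := hmem t (Ioo_subset_Icc_self ht)
    exact hvel _ _ _ _ _ h.1 h.2 h1 h2
  obtain ⟨ma, ba⟩ := exists_memLp_of_norm_le hT hu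
    (stronglyMeasurable_deriv α).aestronglyMeasurable (hv.mono fun _ h => h.1)
  obtain ⟨mc, bc⟩ := exists_memLp_of_norm_le hT hu
    (stronglyMeasurable_deriv z).aestronglyMeasurable (hv.mono fun _ h => h.2)
  have key : ∀ {E : Type} [NormedAddCommGroup E] [InnerProductSpace ℝ E] [FiniteDimensional ℝ E]
      {f : ℝ → E} (_ : AbsolutelyContinuousOnInterval f 0 T)
      (hm : MemLp (deriv f) 2 (volume.restrict (Ioo 0 T))) (t : ℝ) (_ : t ∈ Icc 0 T),
      f t = f 0 + ∫ s in (0 : ℝ)..t, hm.toLp (deriv f) s := by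
    intro E _ _ _ f hf hm t ht
    rw [eq_add_integral_deriv hT hf (intervalIntegrable_of_memLp hT hm) t ht]
    congr 1
    refine intervalIntegral.integral_congr_ae ?_
    have h1 : ∀ᵐ s, s ∈ Ioc 0 T → hm.toLp (deriv f) s = deriv f s := by
      rw [← ae_restrict_iff' measurableSet_Ioc, ← Measure.restrict_congr_set Ioo_ae_eq_Ioc]
      exact hm.coeFn_toLp
    filter_upwards [h1] with s hs' hst
    rw [uIoc_of_le ht.1] at hst
    exact (hs' ⟨hst.1, hst.2.trans ht.2⟩).symm
  have hz : ∀ t ∈ Icc 0 T, |z t| ≤ |z₀| + (R₁ + 1) * (T + 1) := by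
    intro t ht
    rw [key hs.ac_z mc t ht, hs.init_z]
    refine (abs_add_le _ _).trans (add_le_add_right ?_ _)
    have h1 := intervalIntegral.norm_integral_le_integral_norm (f := mc.toLp) (μ := volume) ht.1
    have h2 := intervalIntegral.integral_mono_interval (μ := volume) le_rfl ht.1 ht.2
      (Eventually.of_forall fun s => norm_nonneg (mc.toLp (deriv z) s))
      (intervalIntegrable_of_memLp hT (Lp.memLp mc.toLp)).norm
    -- `R₁` may vanish, and the estimate needs a positive radius.
    have h3 := integral_norm_le_of_norm_le hT (by linarith : 0 < R₁ + 1)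
      (bc.trans (by linarith : R₁ ≤ R₁ + 1))
    have h4 : 0 ≤ (R₁ + 1) * (T + 1) := by positivity
    exact (h1.trans (h2.trans h3)).trans (by linarith)
  have hRT : R₁ ≤ (R₁ + 1) * (T + 1) := by nlinarith
  have habs := abs_nonneg z₀
  refine ⟨fun t ht => ⟨(hmem t ht).2.trans (by nlinarith), (hz t ht).trans (by linarith)⟩,
    ma.toLp, mc.toLp, ma.coeFn_toLp, mc.coeFn_toLp, ba.trans (by linarith),
    bc.trans (by linarith), fun t ht => ⟨?_, ?_⟩⟩
  · rw [← hs.init_alpha]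
    exact key hs.ac_alpha ma t ht
  · rw [← hs.init_z]
    exact key hs.ac_z mc t ht

end Estimates

/-! ### Stability of linear equations under weak limits -/

section Closure

variable {Ω : Type*} [MeasurableSpace Ω] {μ : Measure Ω} [IsFiniteMeasure μ]

/-- Set integrals of weakly convergent functions with values in a finite-dimensional space. -/
theorem tendsto_setIntegral_of_weak {W : Type*} [NormedAddCommGroup W] [InnerProductSpace ℝ W]
    [FiniteDimensional ℝ W] {D : ℝ} {w : ℕ → Lp W 2 μ} {w₀ : Lp W 2 μ} (hD : ∀ k, ‖w k‖ ≤ D)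
    (hw : ∀ y, Tendsto (fun k => inner ℝ (w k) y) atTop (𝓝 (inner ℝ w₀ y)))
    {s : Set Ω} (hs : MeasurableSet s) :
    Tendsto (fun k => ∫ t in s, w k t ∂μ) atTop (𝓝 (∫ t in s, w₀ t ∂μ)) := by
  have := FiniteDimensional.complete ℝ W
  let B := stdOrthonormalBasis ℝ W
  have hi : ∀ x : Lp W 2 μ, Integrable x (μ.restrict s) := fun x =>
    ((Lp.memLp x).integrable one_le_two).restrict
  -- In an orthonormal basis each coordinate is a pairing with a constant function.
  have e : ∀ x : Lp W 2 μ, ∫ t in s, x t ∂μ = ∑ i, (∫ t in s, inner ℝ (B i) (x t) ∂μ) • B i :=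
    fun x => by
      conv_lhs => rw [← B.sum_repr' (∫ t in s, x t ∂μ)]
      exact Finset.sum_congr rfl fun i _ => by rw [integral_inner (hi x)]
  rw [e]
  simp only [fun k => e (w k)]
  refine tendsto_finsetSum _ fun i _ => Tendsto.smul_const ?_ _
  exact tendsto_setIntegral_inner (C := ‖B i‖) (fun _ => aestronglyMeasurable_const)
    (fun _ => Eventually.of_forall fun _ => le_rfl)
    (Eventually.of_forall fun _ => tendsto_const_nhds) hD hw hs

theorem exists_norm_le_of_continuous {X Z : Type*} [NormedAddCommGroup X] [ProperSpace X]
    [NormedAddCommGroup Z] {F : X → Z} (hF : Continuous F) (R : ℝ) :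
    ∃ C, ∀ y : X, ‖y‖ ≤ R → ‖F y‖ ≤ C := by
  obtain ⟨C, hC⟩ := (isCompact_closedBall (0 : X) R).exists_bound_of_continuousOn hF.continuousOn
  exact ⟨C, fun y hy => hC y (by simpa using hy)⟩

/-- Linear equations with continuous state-dependent coefficients are stable under pointwise
convergence of bounded states and weak convergence of the unknowns. -/
theorem ae_eq_of_weak_limit {X A B U : Type*} [NormedAddCommGroup X] [ProperSpace X]
    [NormedAddCommGroup A] [InnerProductSpace ℝ A] [NormedAddCommGroup B] [InnerProductSpace ℝ B]
    [NormedAddCommGroup U] [InnerProductSpace ℝ U]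
    {P : X → A} {Q : X → B} {S : X → U} {g : X → ℝ}
    (hP : Continuous P) (hQ : Continuous Q) (hS : Continuous S) (hg : Continuous g)
    {x : ℕ → Ω → X} {x₀ : Ω → X} {R D : ℝ} (hx : ∀ k, AEStronglyMeasurable (x k) μ)
    (hR : ∀ k, ∀ᵐ t ∂μ, ‖x k t‖ ≤ R)
    (hlim : ∀ᵐ t ∂μ, Tendsto (fun k => x k t) atTop (𝓝 (x₀ t)))
    {a : ℕ → Lp A 2 μ} {c : ℕ → Lp B 2 μ} {u : ℕ → Lp U 2 μ}
    {a₀ : Lp A 2 μ} {c₀ : Lp B 2 μ} {u₀ : Lp U 2 μ}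
    (ha : ∀ k, ‖a k‖ ≤ D) (hc : ∀ k, ‖c k‖ ≤ D) (hu : ∀ k, ‖u k‖ ≤ D)
    (ha' : ∀ y, Tendsto (fun k => inner ℝ (a k) y) atTop (𝓝 (inner ℝ a₀ y)))
    (hc' : ∀ y, Tendsto (fun k => inner ℝ (c k) y) atTop (𝓝 (inner ℝ c₀ y)))
    (hu' : ∀ y, Tendsto (fun k => inner ℝ (u k) y) atTop (𝓝 (inner ℝ u₀ y)))
    (heq : ∀ k, ∀ᵐ t ∂μ, inner ℝ (P (x k t)) (a k t) + inner ℝ (Q (x k t)) (c k t) +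
      inner ℝ (S (x k t)) (u k t) = g (x k t)) :
    ∀ᵐ t ∂μ, inner ℝ (P (x₀ t)) (a₀ t) + inner ℝ (Q (x₀ t)) (c₀ t) +
      inner ℝ (S (x₀ t)) (u₀ t) = g (x₀ t) := by
  have hx₀ : AEStronglyMeasurable x₀ μ := aestronglyMeasurable_of_tendsto_ae atTop hx hlim
  have hR₀ : ∀ᵐ t ∂μ, ‖x₀ t‖ ≤ R := by
    filter_upwards [hlim, ae_all_iff.2 hR] with t h1 h2
    exact le_of_tendsto' h1.norm h2
  obtain ⟨CP, hCP⟩ := exists_norm_le_of_continuous hP R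
  obtain ⟨CQ, hCQ⟩ := exists_norm_le_of_continuous hQ R
  obtain ⟨CS, hCS⟩ := exists_norm_le_of_continuous hS R
  obtain ⟨Cg, hCg⟩ := exists_norm_le_of_continuous hg R
  have iP : ∀ y : Ω → X, AEStronglyMeasurable y μ → (∀ᵐ t ∂μ, ‖y t‖ ≤ R) → ∀ w : Lp A 2 μ,
      Integrable (fun t => inner ℝ (P (y t)) (w t)) μ := fun y h1 h2 w =>
    integrable_inner_of_bound w (hP.comp_aestronglyMeasurable h1) (h2.mono fun t => hCP _)
  have iQ : ∀ y : Ω → X, AEStronglyMeasurable y μ → (∀ᵐ t ∂μ, ‖y t‖ ≤ R) → ∀ w : Lp B 2 μ,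
      Integrable (fun t => inner ℝ (Q (y t)) (w t)) μ := fun y h1 h2 w =>
    integrable_inner_of_bound w (hQ.comp_aestronglyMeasurable h1) (h2.mono fun t => hCQ _)
  have iS : ∀ y : Ω → X, AEStronglyMeasurable y μ → (∀ᵐ t ∂μ, ‖y t‖ ≤ R) → ∀ w : Lp U 2 μ,
      Integrable (fun t => inner ℝ (S (y t)) (w t)) μ := fun y h1 h2 w =>
    integrable_inner_of_bound w (hS.comp_aestronglyMeasurable h1) (h2.mono fun t => hCS _)
  have ig : Integrable (fun t => g (x₀ t)) μ :=
    (integrable_const Cg).mono' (hg.comp_aestronglyMeasurable hx₀) (hR₀.mono fun t => hCg _)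
  refine Integrable.ae_eq_of_forall_setIntegral_eq _ _
    -- Weak limits have no pointwise meaning, so the equation is tested by integration over
    -- arbitrary measurable sets `s`.
    (((iP _ hx₀ hR₀ a₀).add (iQ _ hx₀ hR₀ c₀)).add (iS _ hx₀ hR₀ u₀)) ig fun s hs _ => ?_
  have split : ∀ y : Ω → X, AEStronglyMeasurable y μ → (∀ᵐ t ∂μ, ‖y t‖ ≤ R) →
      ∀ (a : Lp A 2 μ) (c : Lp B 2 μ) (u : Lp U 2 μ),
      ∫ t in s, (inner ℝ (P (y t)) (a t) + inner ℝ (Q (y t)) (c t) + inner ℝ (S (y t)) (u t)) ∂μ =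
      ∫ t in s, inner ℝ (P (y t)) (a t) ∂μ + ∫ t in s, inner ℝ (Q (y t)) (c t) ∂μ +
        ∫ t in s, inner ℝ (S (y t)) (u t) ∂μ := fun y h1 h2 a c u => by
    have h12 : Integrable (fun t => inner ℝ (P (y t)) (a t) + inner ℝ (Q (y t)) (c t))
        (μ.restrict s) := (iP y h1 h2 a).restrict.add (iQ y h1 h2 c).restrict
    rw [integral_add h12 (iS y h1 h2 u).restrict,
      integral_add (iP y h1 h2 a).restrict (iQ y h1 h2 c).restrict]
  have l1 := tendsto_setIntegral_inner (fun k => hP.comp_aestronglyMeasurable (hx k))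
    (fun k => (hR k).mono fun t => hCP _) (hlim.mono fun t ht => (hP.tendsto _).comp ht) ha ha' hs
  have l2 := tendsto_setIntegral_inner (fun k => hQ.comp_aestronglyMeasurable (hx k))
    (fun k => (hR k).mono fun t => hCQ _) (hlim.mono fun t ht => (hQ.tendsto _).comp ht) hc hc' hs
  have l3 := tendsto_setIntegral_inner (fun k => hS.comp_aestronglyMeasurable (hx k))
    (fun k => (hR k).mono fun t => hCS _) (hlim.mono fun t ht => (hS.tendsto _).comp ht) hu hu' hs
  have l4 : Tendsto (fun k => ∫ t in s, g (x k t) ∂μ) atTop (𝓝 (∫ t in s, g (x₀ t) ∂μ)) :=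
    tendsto_integral_of_dominated_convergence (fun _ => Cg)
      (fun k => (hg.comp_aestronglyMeasurable (hx k)).restrict) (integrable_const _)
      (fun k => ae_restrict_of_ae ((hR k).mono fun t => hCg _))
      (ae_restrict_of_ae (hlim.mono fun t ht => (hg.tendsto _).comp ht))
  refine (split x₀ hx₀ hR₀ a₀ c₀ u₀).trans (tendsto_nhds_unique ((l1.add l2).add l3) ?_)
  refine l4.congr fun k => ?_
  rw [← split (x k) (hx k) (hR k)]
  exact (integral_congr_ae (ae_restrict_of_ae (heq k))).symm

end Closure

/-! ### Continuity of the coefficients and reconstruction of a state -/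

section Limit

variable {l T v : ℝ} {n m : ℕ} {φ : Fin n → C1Per l} {b : Fin m → H l}
  {α₀ : EuclideanSpace ℝ (Fin n)} {z₀ : ℝ}

theorem continuous_matB1 (hl : 0 < l) (φ : Fin n → C1Per l) (b : Fin m → H l) :
    Continuous (matB1 φ b) :=
  continuous_matrix fun i _ => (continuous_shift hl (φ i).toL2).inner continuous_const

theorem continuous_matB2 (hl : 0 < l) (φ : Fin n → C1Per l) (b : Fin m → H l) :
    Continuous (matB2 φ b) :=
  continuous_matrix fun i _ => (continuous_shiftDeriv hl (φ i).toL2).inner continuous_const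

theorem inner_toLp_left {k : ℕ} (p : Fin k → ℝ) (y : EuclideanSpace ℝ (Fin k)) :
    inner ℝ (WithLp.toLp 2 p) y = p ⬝ᵥ y.ofLp := by
  rw [EuclideanSpace.inner_eq_star_dotProduct, dotProduct_comm]
  rfl

theorem real_inner_eq_mul (x y : ℝ) : inner ℝ x y = x * y := by
  simp [mul_comm]

/-- Turns weak convergence of velocities into pointwise convergence of states. -/
theorem tendsto_intervalIntegral_of_weak {W : Type} [NormedAddCommGroup W]
    [InnerProductSpace ℝ W] [FiniteDimensional ℝ W] {D : ℝ} {w : ℕ → L2 0 T W} {w₀ : L2 0 T W}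
    (hD : ∀ k, ‖w k‖ ≤ D)
    (hw : ∀ y, Tendsto (fun k => inner ℝ (w k) y) atTop (𝓝 (inner ℝ w₀ y)))
    {t : ℝ} (ht : t ∈ Ioo 0 T) :
    Tendsto (fun k => ∫ s in (0 : ℝ)..t, w k s) atTop (𝓝 (∫ s in (0 : ℝ)..t, w₀ s)) := by
  have h := tendsto_setIntegral_of_weak hD hw (measurableSet_Ioc (a := (0 : ℝ)) (b := t))
  have hsub : Ioc 0 t ⊆ Ioo 0 T := fun s hs => ⟨hs.1, hs.2.trans_lt ht.2⟩
  rw [Measure.restrict_restrict_of_subset hsub] at h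
  simpa only [intervalIntegral.integral_of_le ht.1.le] using h

/-- Functions with square-integrable velocities satisfying the two rows form a state. -/
theorem isState_of_integral (hT : 0 ≤ T) {u : L2 0 T (EuclideanSpace ℝ (Fin m))}
    {a : L2 0 T (EuclideanSpace ℝ (Fin n))} {c : L2 0 T ℝ}
    {α : ℝ → EuclideanSpace ℝ (Fin n)} {z : ℝ → ℝ}
    (hα : α = fun t => α₀ + ∫ s in (0 : ℝ)..t, a s) (hz : z = fun t => z₀ + ∫ s in (0 : ℝ)..t, c s)
    (h1 : ∀ᵐ t ∂volume.restrict (Ioo 0 T), (a t).ofLp + c t • (matN φ *ᵥ (α t).ofLp) =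
      v • (matN φ *ᵥ (α t).ofLp) + matB1 φ b (z t) *ᵥ (u t).ofLp)
    (h2 : ∀ᵐ t ∂volume.restrict (Ioo 0 T), (α t).ofLp ⬝ᵥ ((matN φ)ᵀ *ᵥ (a t).ofLp) +
        ((α t).ofLp ⬝ᵥ (matM2 φ *ᵥ (α t).ofLp)) * c t =
      v * ((α t).ofLp ⬝ᵥ (matM2 φ *ᵥ (α t).ofLp)) +
        (α t).ofLp ⬝ᵥ (matB2 φ b (z t) *ᵥ (u t).ofLp)) :
    IsState T v φ b α₀ z₀ u α z ∧ IsH1 0 T α ∧ IsH1 0 T z := by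
  have ia := intervalIntegrable_of_memLp hT (Lp.memLp a)
  have ic := intervalIntegrable_of_memLp hT (Lp.memLp c)
  have aca : AbsolutelyContinuousOnInterval α 0 T := by
    rw [hα]; exact absolutelyContinuousOnInterval_integral ia α₀
  have acz : AbsolutelyContinuousOnInterval z 0 T := by
    rw [hz]; exact absolutelyContinuousOnInterval_integral ic z₀
  have da : ∀ᵐ t ∂volume.restrict (Ioo 0 T), a t = deriv α t := by
    rw [ae_restrict_iff' measurableSet_Ioo]
    filter_upwards [hasDerivAt_integral_ae ia α₀] with t ht hm
    rw [hα]
    exact (ht (by rw [uIcc_of_le hT]; exact Ioo_subset_Icc_self hm)).deriv.symm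
  have dz : ∀ᵐ t ∂volume.restrict (Ioo 0 T), c t = deriv z t := by
    rw [ae_restrict_iff' measurableSet_Ioo]
    filter_upwards [hasDerivAt_integral_ae ic z₀] with t ht hm
    rw [hz]
    exact (ht (by rw [uIcc_of_le hT]; exact Ioo_subset_Icc_self hm)).deriv.symm
  refine ⟨⟨aca, acz, by simp [hα], by simp [hz], ?_, ?_⟩,
    isH1_of_absolutelyContinuous hT aca ((Lp.memLp a).ae_eq da),
    isH1_of_absolutelyContinuous hT acz ((Lp.memLp c).ae_eq dz)⟩
  · filter_upwards [h1, da, dz] with t h ha hc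
    rwa [ha, hc] at h
  · filter_upwards [h2, da, dz] with t h ha hc
    rwa [ha, hc] at h

end Limit

/-! ### Convergence of the tracking term and of states -/

section Optimal

theorem tendsto_integral_norm_sub_sq {Ω : Type*} [MeasurableSpace Ω] {μ : Measure Ω}
    [IsFiniteMeasure μ] {X V : Type*} [NormedAddCommGroup X] [ProperSpace X]
    [NormedAddCommGroup V] [InnerProductSpace ℝ V]
    {Ψ : X → V} (hΨ : Continuous Ψ) {x : ℕ → Ω → X} {x₀ : Ω → X} {R : ℝ}
    (hx : ∀ k, AEStronglyMeasurable (x k) μ) (hR : ∀ k, ∀ᵐ t ∂μ, ‖x k t‖ ≤ R)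
    (hlim : ∀ᵐ t ∂μ, Tendsto (fun k => x k t) atTop (𝓝 (x₀ t))) (y : Lp V 2 μ) :
    Tendsto (fun k => ∫ t, ‖Ψ (x k t) - y t‖ ^ 2 ∂μ) atTop
      (𝓝 (∫ t, ‖Ψ (x₀ t) - y t‖ ^ 2 ∂μ)) := by
  obtain ⟨C, hC⟩ := exists_norm_le_of_continuous hΨ R
  refine tendsto_integral_of_dominated_convergence (fun t => 2 * (C ^ 2 + ‖y t‖ ^ 2))
    (fun k => ((hΨ.comp_aestronglyMeasurable (hx k)).sub
      (Lp.aestronglyMeasurable y)).norm.pow 2) ?_ (fun k => ?_) ?_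
  · exact ((integrable_const _).add
      ((Lp.memLp y).integrable_norm_pow two_ne_zero)).const_mul 2
  · filter_upwards [hR k] with t ht
    have h1 : ‖Ψ (x k t) - y t‖ ≤ C + ‖y t‖ :=
      (norm_sub_le _ _).trans (by linarith [hC _ ht])
    rw [Real.norm_of_nonneg (by positivity)]
    calc ‖Ψ (x k t) - y t‖ ^ 2 ≤ (C + ‖y t‖) ^ 2 := by gcongr
      _ ≤ 2 * (C ^ 2 + ‖y t‖ ^ 2) := add_sq_le
  · filter_upwards [hlim] with t ht
    exact ((((hΨ.tendsto _).comp ht).sub_const _).norm).pow 2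

variable {l T v : ℝ} {n m : ℕ} {φ : Fin n → C1Per l} {b : Fin m → H l}
  {α₀ : EuclideanSpace ℝ (Fin n)} {z₀ : ℝ}

theorem IsState.aestronglyMeasurable (hT : 0 ≤ T) {u : L2 0 T (EuclideanSpace ℝ (Fin m))}
    {α : ℝ → EuclideanSpace ℝ (Fin n)} {z : ℝ → ℝ} (hs : IsState T v φ b α₀ z₀ u α z) :
    AEStronglyMeasurable (fun t => (α t, z t)) (volume.restrict (Ioo 0 T)) := by
  have h := hs.ac_alpha.continuousOn.prodMk hs.ac_z.continuousOn
  rw [uIcc_of_le hT] at h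
  exact (h.mono Ioo_subset_Icc_self).aestronglyMeasurable measurableSet_Ioo

/-- Weak sequential compactness of bounded sets of controls together with their states. -/
theorem exists_subseq_tendsto_state (hl : 0 < l) (hT : 0 ≤ T) {R : ℝ}
    {u : ℕ → L2 0 T (EuclideanSpace ℝ (Fin m))} {α : ℕ → ℝ → EuclideanSpace ℝ (Fin n)}
    {z : ℕ → ℝ → ℝ} {a : ℕ → L2 0 T (EuclideanSpace ℝ (Fin n))} {c : ℕ → L2 0 T ℝ}
    (hs : ∀ k, IsState T v φ b α₀ z₀ (u k) (α k) (z k))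
    (hu : ∀ k, ‖u k‖ ≤ R) (ha : ∀ k, ‖a k‖ ≤ R) (hc : ∀ k, ‖c k‖ ≤ R)
    (haα : ∀ k, a k =ᵐ[volume.restrict (Ioo 0 T)] deriv (α k))
    (hcz : ∀ k, c k =ᵐ[volume.restrict (Ioo 0 T)] deriv (z k))
    (hR : ∀ k, ∀ t ∈ Icc 0 T, ‖α k t‖ ≤ R ∧ ‖z k t‖ ≤ R)
    (hint : ∀ k, ∀ t ∈ Icc 0 T,
      α k t = α₀ + ∫ s in (0 : ℝ)..t, a k s ∧ z k t = z₀ + ∫ s in (0 : ℝ)..t, c k s) :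
    ∃ (u' : L2 0 T (EuclideanSpace ℝ (Fin m))) (α' : ℝ → EuclideanSpace ℝ (Fin n)) (z' : ℝ → ℝ)
      (σ : ℕ → ℕ), StrictMono σ ∧
      (IsState T v φ b α₀ z₀ u' α' z' ∧ IsH1 0 T α' ∧ IsH1 0 T z') ∧
      (∀ y, Tendsto (fun k => inner ℝ (u (σ k)) y) atTop (𝓝 (inner ℝ u' y))) ∧
      ∀ᵐ t ∂volume.restrict (Ioo 0 T),
        Tendsto (fun k => (α (σ k) t, z (σ k) t)) atTop (𝓝 (α' t, z' t)) := by
  have : Fact ((2 : ENNReal) ≠ ⊤) := ⟨ENNReal.ofNat_ne_top⟩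
  obtain ⟨u', σ₁, hσ₁, hu'⟩ := exists_subseq_weakly_convergent hu
  obtain ⟨a', σ₂, hσ₂, ha'⟩ := exists_subseq_weakly_convergent fun k => ha (σ₁ k)
  obtain ⟨c', σ₃, hσ₃, hc'⟩ := exists_subseq_weakly_convergent fun k => hc (σ₁ (σ₂ k))
  let σ : ℕ → ℕ := fun k => σ₁ (σ₂ (σ₃ k))
  have hσ : StrictMono σ := hσ₁.comp (hσ₂.comp hσ₃)
  have wu : ∀ y, Tendsto (fun k => inner ℝ (u (σ k)) y) atTop (𝓝 (inner ℝ u' y)) := fun y =>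
    (hu' y).comp (hσ₂.comp hσ₃).tendsto_atTop
  have wa : ∀ y, Tendsto (fun k => inner ℝ (a (σ k)) y) atTop (𝓝 (inner ℝ a' y)) := fun y =>
    (ha' y).comp hσ₃.tendsto_atTop
  have wc : ∀ y, Tendsto (fun k => inner ℝ (c (σ k)) y) atTop (𝓝 (inner ℝ c' y)) := hc'
  let α' : ℝ → EuclideanSpace ℝ (Fin n) := fun t => α₀ + ∫ s in (0 : ℝ)..t, a' s
  let z' : ℝ → ℝ := fun t => z₀ + ∫ s in (0 : ℝ)..t, c' s
  have hlim : ∀ᵐ t ∂volume.restrict (Ioo 0 T),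
      Tendsto (fun k => (α (σ k) t, z (σ k) t)) atTop (𝓝 (α' t, z' t)) := by
    filter_upwards [ae_restrict_mem measurableSet_Ioo] with t ht
    refine Tendsto.prodMk_nhds ?_ ?_
    · simp only [fun k => (hint (σ k) t (Ioo_subset_Icc_self ht)).1]
      exact (tendsto_intervalIntegral_of_weak (fun k => ha (σ k)) wa ht).const_add α₀
    · simp only [fun k => (hint (σ k) t (Ioo_subset_Icc_self ht)).2]
      exact (tendsto_intervalIntegral_of_weak (fun k => hc (σ k)) wc ht).const_add z₀
  have hRx : ∀ k, ∀ᵐ t ∂volume.restrict (Ioo 0 T), ‖(α (σ k) t, z (σ k) t)‖ ≤ R := fun k => by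
    filter_upwards [ae_restrict_mem measurableSet_Ioo] with t ht
    exact max_le (hR (σ k) t (Ioo_subset_Icc_self ht)).1 (hR (σ k) t (Ioo_subset_Icc_self ht)).2
  have hx : ∀ k, AEStronglyMeasurable (fun t => (α (σ k) t, z (σ k) t))
      (volume.restrict (Ioo 0 T)) := fun k => (hs (σ k)).aestronglyMeasurable hT
  have cα : Continuous fun x : EuclideanSpace ℝ (Fin n) × ℝ => x.1.ofLp :=
    (PiLp.continuous_ofLp 2 _).comp continuous_fst
  have cN : Continuous fun x : EuclideanSpace ℝ (Fin n) × ℝ => matN φ *ᵥ x.1.ofLp :=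
    continuous_const.matrix_mulVec cα
  have cM : Continuous fun x : EuclideanSpace ℝ (Fin n) × ℝ =>
      x.1.ofLp ⬝ᵥ (matM2 φ *ᵥ x.1.ofLp) := cα.dotProduct (continuous_const.matrix_mulVec cα)
  have cB1 : Continuous fun x : EuclideanSpace ℝ (Fin n) × ℝ => matB1 φ b x.2 :=
    (continuous_matB1 hl φ b).comp continuous_snd
  have cB2 : Continuous fun x : EuclideanSpace ℝ (Fin n) × ℝ => matB2 φ b x.2 :=
    (continuous_matB2 hl φ b).comp continuous_snd
  refine ⟨u', α', z', σ, hσ, isState_of_integral hT (a := a') (c := c') rfl rfl ?_ ?_, wu, hlim⟩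
  -- The vector row is treated by components: the coefficients of `α'`, `z'`, `u` are `eᵢ`, `(N α)ᵢ`
  -- and minus the `i`-th row of `B₁(z)`.
  · have key : ∀ i, ∀ᵐ t ∂volume.restrict (Ioo 0 T),
        (a' t).ofLp i + c' t * (matN φ *ᵥ (α' t).ofLp) i =
          v * (matN φ *ᵥ (α' t).ofLp) i + (matB1 φ b (z' t) *ᵥ (u' t).ofLp) i := fun i => by
      have h := ae_eq_of_weak_limit (μ := volume.restrict (Ioo 0 T))
        (P := fun _ : EuclideanSpace ℝ (Fin n) × ℝ =>
          (WithLp.toLp 2 (Pi.single i 1) : EuclideanSpace ℝ (Fin n)))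
        (Q := fun x => (matN φ *ᵥ x.1.ofLp) i)
        (S := fun x => (WithLp.toLp 2 (-matB1 φ b x.2 i) : EuclideanSpace ℝ (Fin m)))
        (g := fun x => v * (matN φ *ᵥ x.1.ofLp) i)
        continuous_const ((continuous_apply i).comp cN)
        ((PiLp.continuous_toLp 2 _).comp ((continuous_apply i).comp cB1).neg)
        (continuous_const.mul ((continuous_apply i).comp cN)) hx hRx hlim
        (fun k => ha (σ k)) (fun k => hc (σ k)) (fun k => hu (σ k)) wa wc wu (fun k => by
          filter_upwards [(hs (σ k)).row_one, haα (σ k), hcz (σ k)] with t h1 h2 h3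
          have h4 := congrFun h1 i
          simp only [Pi.add_apply, Pi.smul_apply, smul_eq_mul] at h4
          rw [show (matB1 φ b (z (σ k) t) *ᵥ (u (σ k) t).ofLp) i =
            matB1 φ b (z (σ k) t) i ⬝ᵥ (u (σ k) t).ofLp from rfl] at h4
          simp only [inner_toLp_left, single_one_dotProduct, real_inner_eq_mul, neg_dotProduct, h2,
            h3]
          linarith)
      filter_upwards [h] with t ht
      simp only [inner_toLp_left, single_one_dotProduct, real_inner_eq_mul, neg_dotProduct] at ht
      rw [show (matB1 φ b (z' t) *ᵥ (u' t).ofLp) i = matB1 φ b (z' t) i ⬝ᵥ (u' t).ofLp from rfl]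
      linarith
    filter_upwards [ae_all_iff.2 key] with t ht
    exact funext fun i => ht i
  -- Since `αᵀ Nᵀ α' = (N α) · α'`, the coefficient of `α'` in the second row is `N α`.
  · have h := ae_eq_of_weak_limit (μ := volume.restrict (Ioo 0 T))
      (P := fun x : EuclideanSpace ℝ (Fin n) × ℝ =>
        (WithLp.toLp 2 (matN φ *ᵥ x.1.ofLp) : EuclideanSpace ℝ (Fin n)))
      (Q := fun x => x.1.ofLp ⬝ᵥ (matM2 φ *ᵥ x.1.ofLp))
      (S := fun x => (WithLp.toLp 2 (-(x.1.ofLp ᵥ* matB2 φ b x.2)) : EuclideanSpace ℝ (Fin m)))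
      (g := fun x => v * (x.1.ofLp ⬝ᵥ (matM2 φ *ᵥ x.1.ofLp)))
      ((PiLp.continuous_toLp 2 _).comp cN) cM
      ((PiLp.continuous_toLp 2 _).comp (cα.matrix_vecMul cB2).neg)
      (continuous_const.mul cM) hx hRx hlim
      (fun k => ha (σ k)) (fun k => hc (σ k)) (fun k => hu (σ k)) wa wc wu (fun k => by
        filter_upwards [(hs (σ k)).row_two, haα (σ k), hcz (σ k)] with t h1 h2 h3
        rw [Matrix.mulVec_transpose, dotProduct_comm, ← Matrix.dotProduct_mulVec,
          dotProduct_comm, Matrix.dotProduct_mulVec _ (matB2 φ b _)] at h1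
        simp only [inner_toLp_left, real_inner_eq_mul, neg_dotProduct, h2, h3]
        linarith)
    filter_upwards [h] with t ht
    simp only [inner_toLp_left, real_inner_eq_mul, neg_dotProduct] at ht
    rw [Matrix.mulVec_transpose, dotProduct_comm, ← Matrix.dotProduct_mulVec,
      dotProduct_comm, Matrix.dotProduct_mulVec _ (matB2 φ b _)]
    linarith

/-- Without control, the profile is transported with constant coefficients. -/
theorem isState_zero (φ : Fin n → C1Per l) (b : Fin m → H l) (α₀ : EuclideanSpace ℝ (Fin n))
    (z₀ : ℝ) : IsState T v φ b α₀ z₀ 0 (fun _ => α₀) (fun t => z₀ + v * t) where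
  ac_alpha := contDiffOn_const.absolutelyContinuousOnInterval
  ac_z :=
    (contDiff_const.add (contDiff_const.mul contDiff_id)).contDiffOn.absolutelyContinuousOnInterval
  init_alpha := rfl
  init_z := by simp
  row_one := by
    filter_upwards [Lp.coeFn_zero (EuclideanSpace ℝ (Fin m)) 2 (volume.restrict (Ioo 0 T))]
      with t ht
    have hd : deriv (fun t => z₀ + v * t) t = v := by simp
    have h0 : (0 : L2 0 T (EuclideanSpace ℝ (Fin m))) t = 0 := ht
    rw [h0]
    simp [hd]
  row_two := by
    filter_upwards [Lp.coeFn_zero (EuclideanSpace ℝ (Fin m)) 2 (volume.restrict (Ioo 0 T))]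
      with t ht
    have hd : deriv (fun t => z₀ + v * t) t = v := by simp
    have h0 : (0 : L2 0 T (EuclideanSpace ℝ (Fin m))) t = 0 := ht
    rw [h0]
    simp [hd, mul_comm]

theorem cost_eq (T μ : ℝ) (φ : Fin n → C1Per l) (yd : L2 0 T (H l))
    (α : ℝ → EuclideanSpace ℝ (Fin n)) (z : ℝ → ℝ) (u : L2 0 T (EuclideanSpace ℝ (Fin m))) :
    cost T μ φ yd α z u =
      1 / 2 * (∫ t in Ioo 0 T, ‖(∑ i, α t i • shift l (z t) (φ i).toL2) - yd t‖ ^ 2) +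
        μ / 2 * ‖u‖ ^ 2 := by
  rw [cost, norm_sq_eq_integral]

theorem continuous_sum_smul_shift (hl : 0 < l) (φ : Fin n → C1Per l) :
    Continuous fun x : EuclideanSpace ℝ (Fin n) × ℝ => ∑ i, x.1 i • shift l x.2 (φ i).toL2 :=
  continuous_finsetSum _ fun i _ =>
    ((EuclideanSpace.proj (𝕜 := ℝ) i).continuous.comp continuous_fst).smul
      ((continuous_shift hl (φ i).toL2).comp continuous_snd)

end Optimal

end SPOD

/-! ### Existence of an optimal control -/

theorem theorem3p2 {l T : ℝ} (hl : 0 < l) (hT : 0 < T) (v : ℝ) {n m : ℕ}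
    (φ : Fin n → SPOD.C1Per l)
    (hφ : Orthonormal ℝ fun i => (φ i).toL2)
    (hφ' : LinearIndependent ℝ
      (Sum.elim (fun i => (φ i).toL2) (fun i => (φ i).derivL2) : Fin n ⊕ Fin n → SPOD.H l))
    (b : Fin m → SPOD.H l) (hb : ∀ k, b k ∈ SPOD.H1Per l) (hb0 : ∀ k, b k ≠ 0)
    (α₀ : EuclideanSpace ℝ (Fin n)) (hα₀ : α₀ ≠ 0) (z₀ : ℝ)
    (yd : SPOD.L2 0 T (SPOD.H l)) :
    ∃ μ₀ : ℝ, 0 < μ₀ ∧ ∀ μ : ℝ, μ₀ ≤ μ →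
      ∃ (u : SPOD.L2 0 T (EuclideanSpace ℝ (Fin m)))
        (α : ℝ → EuclideanSpace ℝ (Fin n)) (z : ℝ → ℝ),
        SPOD.IsOptimalControl T v μ φ b α₀ z₀ yd u α z ∧
          SPOD.IsH1 0 T α ∧ SPOD.IsH1 0 T z := by
  obtain ⟨δ, hδ, R, hbound⟩ := SPOD.exists_uniform_bounds hl hT.le hφ hφ' v b hα₀ z₀
  obtain ⟨track, htrack⟩ : ∃ F : (ℝ → EuclideanSpace ℝ (Fin n)) → (ℝ → ℝ) → ℝ, ∀ α z,
      F α z = ∫ t in Ioo 0 T,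
        ‖(∑ i, α t i • SPOD.shift l (z t) (φ i).toL2) - yd t‖ ^ 2 := ⟨_, fun _ _ => rfl⟩
  have hcost : ∀ μ α z (u : SPOD.L2 0 T (EuclideanSpace ℝ (Fin m))),
      SPOD.cost T μ φ yd α z u = 1 / 2 * track α z + μ / 2 * ‖u‖ ^ 2 := fun μ α z u => by
    rw [SPOD.cost_eq, htrack]
  have htrack0 : ∀ α z, 0 ≤ track α z := fun α z => by
    rw [htrack]
    exact integral_nonneg fun t => by positivity
  set J₀ := 1 / 2 * track (fun _ => α₀) (fun t => z₀ + v * t)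
  have hJ₀ : 0 ≤ J₀ := mul_nonneg (by norm_num) (htrack0 _ _)
  -- A cost at most `J₀ + 1` then forces `μ / 2 * ‖u‖² ≤ J₀ + 1 ≤ μ / 2 * δ²`, so `‖u‖ ≤ δ`. Neither
  -- `J₀` nor `δ` depends on `μ`; the slack `1` covers the excess `1 / (k + 1)` of the minimizing
  -- sequence.
  refine ⟨2 * (J₀ + 1) / δ ^ 2, by positivity, fun μ hμ => ?_⟩
  have hμ0 : 0 < μ := lt_of_lt_of_le (by positivity) hμ
  let costs : Set ℝ := {x | ∃ u α z, SPOD.IsState T v φ b α₀ z₀ u α z ∧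
    SPOD.cost T μ φ yd α z u = x}
  have hbelow : BddBelow costs := ⟨0, by
    rintro _ ⟨u, α, z, -, rfl⟩
    rw [hcost]
    have := htrack0 α z
    positivity⟩
  have hmem : J₀ ∈ costs := ⟨0, _, _, SPOD.isState_zero φ b α₀ z₀, by rw [hcost]; simp [J₀]⟩
  have hinf : sInf costs ≤ J₀ := csInf_le hbelow hmem
  have hex : ∀ k : ℕ, ∃ u α z, SPOD.IsState T v φ b α₀ z₀ u α z ∧
      SPOD.cost T μ φ yd α z u < sInf costs + 1 / ((k : ℝ) + 1) := fun k => by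
    obtain ⟨_, ⟨u, α, z, hs, rfl⟩, hlt⟩ := exists_lt_of_csInf_lt ⟨J₀, hmem⟩
      (lt_add_of_pos_right (sInf costs) (by positivity : (0 : ℝ) < 1 / ((k : ℝ) + 1)))
    exact ⟨u, α, z, hs, hlt⟩
  choose u α z hs hlt using hex
  have hcostlim : Filter.Tendsto (fun k => SPOD.cost T μ φ yd (α k) (z k) (u k)) Filter.atTop
      (nhds (sInf costs)) := by
    refine tendsto_of_tendsto_of_tendsto_of_le_of_le tendsto_const_nhds
      (by simpa using tendsto_one_div_add_atTop_nhds_zero_nat.const_add (sInf costs))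
      (fun k => csInf_le hbelow ⟨_, _, _, hs k, rfl⟩) fun k => (hlt k).le
  have hu : ∀ k, ‖u k‖ ≤ δ := fun k => by
    refine le_of_sq_le_sq ?_ hδ.le
    have h1 : SPOD.cost T μ φ yd (α k) (z k) (u k) ≤ J₀ + 1 := by
      have : 1 / ((k : ℝ) + 1) ≤ 1 := by
        rw [div_le_one (by positivity)]
        linarith [(Nat.cast_nonneg k : (0 : ℝ) ≤ k)]
      linarith [hlt k]
    rw [hcost] at h1
    rw [div_le_iff₀ (by positivity)] at hμ
    have h2 := htrack0 (α k) (z k)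
    have h3 : μ * ‖u k‖ ^ 2 ≤ μ * δ ^ 2 := by linarith
    exact le_of_mul_le_mul_left h3 hμ0
  have hB := fun k => hbound _ _ _ (hs k) (hu k)
  choose hR a c haα hcz ha hc hint using hB
  obtain ⟨u', α', z', σ, hσ, hstate, hw, hlim⟩ :=
    SPOD.exists_subseq_tendsto_state (R := max R δ) hl hT.le hs
      (fun k => (hu k).trans (le_max_right _ _)) (fun k => (ha k).trans (le_max_left _ _))
      (fun k => (hc k).trans (le_max_left _ _)) haα hcz
      (fun k t ht => ⟨(hR k t ht).1.trans (le_max_left _ _),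
        (hR k t ht).2.trans (le_max_left _ _)⟩) hint
  refine ⟨u', α', z', ⟨hstate.1, fun u'' α'' z'' hs'' => ?_⟩, hstate.2⟩
  have htr : Filter.Tendsto (fun k => track (α (σ k)) (z (σ k))) Filter.atTop
      (nhds (track α' z')) := by
    simp only [htrack]
    exact SPOD.tendsto_integral_norm_sub_sq (SPOD.continuous_sum_smul_shift hl φ)
      (x := fun k t => (α (σ k) t, z (σ k) t)) (x₀ := fun t => (α' t, z' t)) (R := R)
      (fun k => (hs (σ k)).aestronglyMeasurable hT.le) (fun k => by
        filter_upwards [ae_restrict_mem measurableSet_Ioo] with t ht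
        exact max_le (hR (σ k) t (Ioo_subset_Icc_self ht)).1
          (hR (σ k) t (Ioo_subset_Icc_self ht)).2) hlim yd
  -- Cost and tracking term both converge, so the squared norms converge too, with limit read off
  -- from the cost formula.
  have hnorm : Filter.Tendsto (fun k => ‖u (σ k)‖ ^ 2) Filter.atTop
      (nhds (2 / μ * (sInf costs - 1 / 2 * track α' z'))) := by
    refine (((hcostlim.comp hσ.tendsto_atTop).sub (htr.const_mul (1 / 2))).const_mul
      (2 / μ)).congr fun k => ?_
    simp only [Function.comp_apply, hcost]
    field_simp
    ring
  have hle := SPOD.sq_norm_le_of_weak hw hnorm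
  have hle2 : SPOD.cost T μ φ yd α' z' u' ≤ sInf costs := by
    rw [hcost]
    have h1 : μ / 2 * ‖u'‖ ^ 2 ≤ μ / 2 * (2 / μ * (sInf costs - 1 / 2 * track α' z')) :=
      mul_le_mul_of_nonneg_left hle (by positivity)
    have h2 : μ / 2 * (2 / μ * (sInf costs - 1 / 2 * track α' z')) =
        sInf costs - 1 / 2 * track α' z' := by field_simp
    linarith
  exact hle2.trans (csInf_le hbelow ⟨_, _, _, hs'', rfl⟩)
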